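/- Let $U_1, U_2, \dots$ be independent random points, each uniformly distributed on the unit circle $\{x\in\mathbb{R}^2 : \|x\|=1\}$. For points $x,y,z$ of the circle let $\mathrm{peri}(x,y,z)=\|x-y\|+\|y-z\|+\|z-x\|$ be the perimeter of the triangle with vertices $x,y,z$, and for $n\ge 3$ put $H_n=\max_{1\le i<j<\ell\le n}\mathrm{peri}(U_i,U_j,U_\ell)$. Then, for every $t>0$, $$\lim_{n\to\infty}\mathbf{P}\bigl\{n^3(3\sqrt3-H_n)\le t\bigr\}=1-\exp\Bigl\{-\frac{2t}{9\pi}\Bigr\},$$ and the rate of convergence is $O(n^{-1/2})$: for every $t>0$, $$\mathbf{P}\bigl\{n^3(3\sqrt3-H_n)\le t\bigr\}-\Bigl(1-\exp\Bigl\{-\frac{2t}{9\pi}\Bigr\}\Bigr)=O\bigl(n^{-1/2}\bigr)\qquad(n\to\infty),$$ where the implied constant may depend on $t$. -/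

import Mathlib

open MeasureTheory ProbabilityTheory Filter Topology Asymptotics

noncomputable section

/-- The unit circle, in the Euclidean plane `ℂ`. -/
abbrev UnitCircle : Type := Metric.sphere (0 : ℂ) 1

/-- The point `exp (i θ)` of the unit circle. -/
def circlePoint (θ : ℝ) : UnitCircle :=
  ⟨circleMap 0 1 θ, circleMap_mem_sphere 0 zero_le_one θ⟩

/-- The uniform distribution on the unit circle (normalized arc length): the law of
`exp (i θ)` for an angle `θ` uniformly distributed on `(0, 2π]`. -/
def uniformCircle : Measure UnitCircle :=
  (cond (volume : Measure ℝ) (Set.Ioc 0 (2 * Real.pi))).map circlePoint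

/-- The perimeter of the (possibly degenerate) triangle with vertices `x`, `y`, `z`, whose sides
are straight segments: the distance on `UnitCircle` is the Euclidean distance of `ℂ`. -/
def perimeter (x y z : UnitCircle) : ℝ :=
  dist x y + dist y z + dist z x

/-- The largest perimeter of the triangles with vertices among the first `n` points
`u 0, …, u (n - 1)` of a sequence. For `3 ≤ n` the set is finite and nonempty, so that the supremum
is a maximum; for `n < 3` there are no triples and the value is `0`. -/
def maxPerimeter (u : ℕ → UnitCircle) (n : ℕ) : ℝ :=
  sSup {r : ℝ | ∃ i j l : ℕ, i < j ∧ j < l ∧ l < n ∧ r = perimeter (u i) (u j) (u l)}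

end

/-! Call a triple of points good if its triangle has perimeter at least `3√3 - s`, with `s = t /
n³`. The event in question says that at least one triple is good. Good triples are rare and only
weakly dependent, so their number is nearly Poisson, and everything reduces to its mean and to the
error of the Poisson approximation.

Mean. By rotation invariance one vertex may be fixed. The perimeter is twice the sum of the sines of
three half-arcs with sum `π`. Around the equilateral triangle the first-order terms cancel, and the
deficit is `√3/2` times the sum of squares of the half-arc deviations, up to a cubic error. The good
pairs of angles therefore fill, up to order, an ellipse of area `8πs/3` to leading order; the
probability of being good is `4s/(3π) + O(s^(3/2))` (`abs_goodProb_sub_le`), and multiplying by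
`n³/6` gives the mean `2t/(9π)` in the limit.

Poisson error. The Chen-Stein bound `abs_measureReal_hits_eq_zero_sub_exp_le` sums over pairs of
triples that meet. Triples with one common vertex are independent given that vertex, so about `n⁵`
pairs contribute `O(s²)` each, in all `O(1/n)`. Two triples with two common vertices are both good
only if three sides from one common vertex are within `O(√s)` of `√3`, which has probability
`O(s^(3/2))`; about `n⁴` such pairs contribute `O(n^(-1/2))`. This last term dictates the rate. The
limit follows from the rate. -/

noncomputable section

/-! ### Chen-Stein bound for dissociated events -/

/-- The Stein function of the Poisson law with mean `r` for the test set `{0}`, shifted by one. -/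
def steinZero (r : ℝ) (k : ℕ) : ℝ := ∫ u in (0 : ℝ)..1, u ^ k * Real.exp (-(r * u))

theorem steinZero_zero (r : ℝ) : r * steinZero r 0 = 1 - Real.exp (-r) := by
  have h : ∀ u ∈ Set.uIcc (0 : ℝ) 1, HasDerivAt (fun u : ℝ => -Real.exp (-(r * u)))
      (r * (u ^ 0 * Real.exp (-(r * u)))) u := by
    intro u _
    have h1 : HasDerivAt (fun u : ℝ => Real.exp (-(r * u))) (Real.exp (-(r * u)) * (-r)) u := by
      simpa using ((hasDerivAt_id u).const_mul r).neg.exp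
    refine h1.neg.congr_deriv ?_
    ring
  rw [steinZero, ← intervalIntegral.integral_const_mul,
    intervalIntegral.integral_eq_sub_of_hasDerivAt h
      (Continuous.intervalIntegrable (by fun_prop) _ _)]
  simp
  ring

/-- Integrate the derivative of `-u ^ (k + 1) * exp (-r u)` over `[0, 1]`. Together with
`steinZero_zero` this is the Stein equation for the indicator of `{0}`; the integral form makes the
bounds `0` and `1` on the solution immediate. -/
theorem steinZero_succ (r : ℝ) (k : ℕ) :
    r * steinZero r (k + 1) - (k + 1) * steinZero r k = -Real.exp (-r) := by
  have h : ∀ u ∈ Set.uIcc (0 : ℝ) 1, HasDerivAt (fun u : ℝ => -(u ^ (k + 1) * Real.exp (-(r * u))))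
      (r * (u ^ (k + 1) * Real.exp (-(r * u))) - (k + 1) * (u ^ k * Real.exp (-(r * u)))) u := by
    intro u _
    have h1 : HasDerivAt (fun u : ℝ => Real.exp (-(r * u))) (Real.exp (-(r * u)) * (-r)) u := by
      simpa using ((hasDerivAt_id u).const_mul r).neg.exp
    refine ((hasDerivAt_pow (k + 1) u).mul h1).neg.congr_deriv ?_
    rw [Nat.add_sub_cancel]
    push_cast
    ring
  rw [steinZero, steinZero, ← intervalIntegral.integral_const_mul,
    ← intervalIntegral.integral_const_mul, ← intervalIntegral.integral_sub,
    intervalIntegral.integral_eq_sub_of_hasDerivAt h]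
  · simp
  all_goals exact Continuous.intervalIntegrable (by fun_prop) _ _

theorem steinZero_nonneg (r : ℝ) (k : ℕ) : 0 ≤ steinZero r k :=
  intervalIntegral.integral_nonneg zero_le_one fun u hu => by
    have := hu.1
    positivity

theorem steinZero_le_one {r : ℝ} (hr : 0 ≤ r) (k : ℕ) : steinZero r k ≤ 1 := by
  have : steinZero r k ≤ ∫ _ in (0 : ℝ)..1, (1 : ℝ) := by
    refine intervalIntegral.integral_mono_on zero_le_one
      (Continuous.intervalIntegrable (by fun_prop) _ _)
      (Continuous.intervalIntegrable (by fun_prop) _ _) fun u hu => ?_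
    have h0 : 0 ≤ r * u := mul_nonneg hr hu.1
    exact mul_le_one₀ (pow_le_one₀ hu.1 hu.2) (Real.exp_pos _).le (Real.exp_le_one_iff.2 (by linarith))
  simpa using this

theorem abs_steinZero_sub_le {r : ℝ} (hr : 0 ≤ r) (j k : ℕ) :
    |steinZero r j - steinZero r k| ≤ 1 := by
  have := steinZero_nonneg r j
  have := steinZero_nonneg r k
  have := steinZero_le_one hr j
  have := steinZero_le_one hr k
  rw [abs_le]
  constructor <;> linarith

/-- The number of the events `A j`, `j ∈ T`, that occur. -/
def hits {Ω ι : Type*} (A : ι → Set Ω) (T : Finset ι) (ω : Ω) : ℕ :=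
  ∑ j ∈ T, (A j).indicator 1 ω

theorem measurable_hits {Ω ι : Type*} [MeasurableSpace Ω] {A : ι → Set Ω}
    (hA : ∀ i, MeasurableSet (A i)) (T : Finset ι) : Measurable (hits A T) :=
  Finset.measurable_fun_sum _ fun i _ => measurable_one.indicator (hA i)

theorem cast_hits {Ω ι : Type*} (A : ι → Set Ω) (T : Finset ι) (ω : Ω) :
    (hits A T ω : ℝ) = ∑ j ∈ T, (A j).indicator (1 : Ω → ℝ) ω := by
  rw [hits, Nat.cast_sum]
  refine Finset.sum_congr rfl fun j _ => ?_
  by_cases h : ω ∈ A j <;> simp [h]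

theorem hits_eq_zero_iff {Ω ι : Type*} (A : ι → Set Ω) (T : Finset ι) (ω : Ω) :
    hits A T ω = 0 ↔ ∀ j ∈ T, ω ∉ A j := by
  simp [hits, Finset.sum_eq_zero_iff]

theorem hits_sdiff_add {Ω ι : Type*} [DecidableEq ι] (A : ι → Set Ω) {S T : Finset ι}
    (h : T ⊆ S) (ω : Ω) : hits A (S \ T) ω + hits A T ω = hits A S ω :=
  Finset.sum_sdiff h

/-- The error in replacing the hits in `S` by the hits in `S \ T` inside the Stein function is at
most the number of hits in `T`. -/
theorem abs_steinZero_hits_sub_le {Ω ι : Type*} [DecidableEq ι] (A : ι → Set Ω) {S T : Finset ι}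
    (h : T ⊆ S) {r : ℝ} (hr : 0 ≤ r) (ω : Ω) :
    |steinZero r (hits A (S \ T) ω) - steinZero r (hits A S ω)| ≤ hits A T ω := by
  have hadd := hits_sdiff_add A h ω
  rcases Nat.eq_zero_or_pos (hits A T ω) with h0 | h0
  · rw [h0, add_zero] at hadd
    simp [hadd, h0]
  · exact (abs_steinZero_sub_le hr _ _).trans (by exact_mod_cast h0)

/-- The Stein equation evaluated at the number of hits and integrated. The truncated subtraction
`hits - 1` is harmless: on `A i` at least one event occurs, and off `A i` the indicator vanishes. -/
theorem integral_steinZero {Ω ι : Type*} [MeasurableSpace Ω] (P : Measure Ω)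
    [IsProbabilityMeasure P] (S : Finset ι) (A : ι → Set Ω) (hA : ∀ i, MeasurableSet (A i))
    {r : ℝ} (hr : 0 ≤ r) :
    P.real {ω | hits A S ω = 0} - Real.exp (-r) =
      r * ∫ ω, steinZero r (hits A S ω) ∂P
        - ∑ i ∈ S, ∫ ω, (A i).indicator (fun ω => steinZero r (hits A S ω - 1)) ω ∂P := by
  have hint : ∀ g : Ω → ℕ, Measurable g → Integrable (fun ω => steinZero r (g ω)) P := by
    intro g hg
    refine Integrable.of_bound ((measurable_from_nat (f := steinZero r)).comp hg).aestronglyMeasurable 1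
      (Eventually.of_forall fun ω => ?_)
    rw [Real.norm_eq_abs, abs_of_nonneg (steinZero_nonneg _ _)]
    exact steinZero_le_one hr _
  have hm := measurable_hits hA S
  have hI : ∀ i ∈ S, Integrable ((A i).indicator (fun ω => steinZero r (hits A S ω - 1))) P :=
    fun i _ => (hint _ (hm.sub_const 1)).indicator (hA i)
  rw [← integral_finsetSum S hI, ← integral_const_mul, ← integral_sub
    ((hint _ hm).const_mul r) (integrable_finsetSum S hI)]
  have hset : MeasurableSet {ω | hits A S ω = 0} := hm (measurableSet_singleton 0)
  have : P.real {ω | hits A S ω = 0} - Real.exp (-r)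
      = ∫ ω, ({ω | hits A S ω = 0}.indicator (1 : Ω → ℝ) ω - Real.exp (-r)) ∂P := by
    rw [integral_sub (IntegrableOn.integrable_indicator (integrable_const _).integrableOn hset)
      (integrable_const _), integral_indicator_one hset]
    simp
  rw [this]
  refine integral_congr_ae (Eventually.of_forall fun ω => ?_)
  have hsum : ∑ i ∈ S, (A i).indicator (fun ω => steinZero r (hits A S ω - 1)) ω
      = hits A S ω * steinZero r (hits A S ω - 1) := by
    rw [cast_hits, Finset.sum_mul]
    refine Finset.sum_congr rfl fun i _ => ?_
    by_cases h : ω ∈ A i <;> simp [h]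
  simp only [hsum]
  rcases h : hits A S ω with _ | k
  · have := steinZero_zero r
    simp [Set.indicator, h]
    linarith
  · have := steinZero_succ r k
    simp [Set.indicator, h]
    linarith

/-- Poisson approximation, by the Chen-Stein method, of the probability that none of the events
`A i` occurs, for dissociated events: `A i` is independent of the number of events that occur
outside the neighbourhood `N i` of `i`. -/
theorem abs_measureReal_hits_eq_zero_sub_exp_le {Ω ι : Type*} [DecidableEq ι] [MeasurableSpace Ω]
    (P : Measure Ω) [IsProbabilityMeasure P] (S : Finset ι) (A : ι → Set Ω)
    (hA : ∀ i, MeasurableSet (A i)) (N : ι → Finset ι) (hself : ∀ i ∈ S, i ∈ N i)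
    (hNS : ∀ i ∈ S, N i ⊆ S)
    (hind : ∀ i ∈ S, IndepFun ((A i).indicator (1 : Ω → ℝ)) (hits A (S \ N i)) P) :
    |P.real {ω | hits A S ω = 0} - Real.exp (-∑ i ∈ S, P.real (A i))| ≤
      ∑ i ∈ S, (∑ j ∈ N i, P.real (A i) * P.real (A j)
        + ∑ j ∈ (N i).erase i, P.real (A i ∩ A j)) := by
  set r := ∑ i ∈ S, P.real (A i) with hrdef
  have hr : 0 ≤ r := Finset.sum_nonneg fun i _ => measureReal_nonneg
  have hint : ∀ g : Ω → ℕ, Measurable g → Integrable (fun ω => steinZero r (g ω)) P := by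
    intro g hg
    refine Integrable.of_bound ((measurable_from_nat (f := steinZero r)).comp hg).aestronglyMeasurable 1
      (Eventually.of_forall fun ω => ?_)
    rw [Real.norm_eq_abs, abs_of_nonneg (steinZero_nonneg _ _)]
    exact steinZero_le_one hr _
  have hintH : ∀ T : Finset ι, Integrable (fun ω => (hits A T ω : ℝ)) P := by
    intro T
    simp_rw [cast_hits]
    exact integrable_finsetSum _ fun i _ =>
      IntegrableOn.integrable_indicator (integrable_const _).integrableOn (hA i)
  have hm := fun T => measurable_hits hA T
  rw [integral_steinZero P S A hA hr]
  have hrsum : r * ∫ ω, steinZero r (hits A S ω) ∂P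
      = ∑ i ∈ S, P.real (A i) * ∫ ω, steinZero r (hits A S ω) ∂P := by
    rw [hrdef, Finset.sum_mul]
  rw [hrsum, ← Finset.sum_sub_distrib]
  refine (Finset.abs_sum_le_sum_abs _ _).trans (Finset.sum_le_sum fun i hi => ?_)
  -- Hits outside `N i` are independent of `A i`, so here the expectation factors exactly. The two
  -- remaining errors come from discarding the neighbourhood: `e1` in the product term, `e2` in the
  -- term restricted to `A i`.
  have hprod : ∫ ω, (A i).indicator (fun ω => steinZero r (hits A (S \ N i) ω)) ω ∂P
      = P.real (A i) * ∫ ω, steinZero r (hits A (S \ N i) ω) ∂P := by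
    have h1 : IndepFun (id ∘ (A i).indicator (1 : Ω → ℝ)) (steinZero r ∘ hits A (S \ N i)) P :=
      (hind i hi).comp measurable_id measurable_from_nat
    have h2 := h1.integral_mul_eq_mul_integral
      ((measurable_one.indicator (hA i)).aestronglyMeasurable)
      (((measurable_from_nat (f := steinZero r)).comp (hm _)).aestronglyMeasurable)
    rw [← integral_indicator_one (hA i)]
    refine Eq.trans (integral_congr_ae (Eventually.of_forall fun ω => ?_)) h2
    by_cases h : ω ∈ A i <;> simp [h]
  have e1 : |∫ ω, steinZero r (hits A (S \ N i) ω) ∂P - ∫ ω, steinZero r (hits A S ω) ∂P|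
      ≤ ∑ j ∈ N i, P.real (A j) := by
    rw [← integral_sub (hint _ (hm _)) (hint _ (hm _))]
    refine (abs_integral_le_integral_abs).trans ?_
    refine (integral_mono ((hint _ (hm _)).sub (hint _ (hm _))).abs (hintH (N i))
      fun ω => abs_steinZero_hits_sub_le A (hNS i hi) hr ω).trans (le_of_eq ?_)
    simp_rw [cast_hits]
    rw [integral_finsetSum _ fun j _ =>
      IntegrableOn.integrable_indicator (integrable_const _).integrableOn (hA j)]
    exact Finset.sum_congr rfl fun j _ => integral_indicator_one (hA j)
  have e2 : |∫ ω, (A i).indicator (fun ω => steinZero r (hits A (S \ N i) ω)) ω ∂P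
      - ∫ ω, (A i).indicator (fun ω => steinZero r (hits A S ω - 1)) ω ∂P|
      ≤ ∑ j ∈ (N i).erase i, P.real (A i ∩ A j) := by
    have i1 := (hint _ (hm (S \ N i))).indicator (hA i)
    have i2 := (hint _ ((hm S).sub_const 1)).indicator (hA i)
    rw [← integral_sub i1 i2]
    refine (abs_integral_le_integral_abs).trans ?_
    refine (integral_mono (i1.sub i2).abs ((hintH ((N i).erase i)).indicator (hA i))
      fun ω => ?_).trans (le_of_eq ?_)
    · by_cases h : ω ∈ A i
      · simp only [h, Set.indicator_of_mem, Pi.sub_apply]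
        have hadd := hits_sdiff_add A (hNS i hi) ω
        -- On `A i` the event `i` itself accounts for the one hit subtracted, so the two arguments
        -- agree unless another neighbour occurs.
        have hadd' : hits A ((N i).erase i) ω + 1 = hits A (N i) ω := by
          have := Finset.sum_erase_add (N i) (fun j => (A j).indicator (1 : Ω → ℕ) ω) (hself i hi)
          simpa [hits, h] using this
        rcases Nat.eq_zero_or_pos (hits A ((N i).erase i) ω) with h0 | h0
        · have : hits A S ω - 1 = hits A (S \ N i) ω := by omega
          simp [this, h0]
        · exact (abs_steinZero_sub_le hr _ _).trans (by exact_mod_cast h0)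
      · simp [h]
    · have : ∀ ω, (A i).indicator (fun ω => (hits A ((N i).erase i) ω : ℝ)) ω
          = ∑ j ∈ (N i).erase i, (A i ∩ A j).indicator (1 : Ω → ℝ) ω := by
        intro ω
        by_cases h : ω ∈ A i
        · simp only [h, Set.indicator_of_mem, cast_hits]
          refine Finset.sum_congr rfl fun j _ => ?_
          by_cases h' : ω ∈ A j <;> simp [h, h']
        · simp [h]
      simp_rw [this]
      rw [integral_finsetSum _ fun j _ =>
        IntegrableOn.integrable_indicator (integrable_const _).integrableOn ((hA i).inter (hA j))]
      exact Finset.sum_congr rfl fun j _ => integral_indicator_one ((hA i).inter (hA j))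
  rw [← Finset.mul_sum]
  have e3 := mul_le_mul_of_nonneg_left e1 (measureReal_nonneg (μ := P) (s := A i))
  rw [← abs_of_nonneg (measureReal_nonneg (μ := P) (s := A i)), ← abs_mul,
    abs_of_nonneg (measureReal_nonneg (μ := P) (s := A i)), mul_sub, ← hprod] at e3
  rw [abs_le] at *
  constructor <;> linarith [e2.1, e2.2, e3.1, e3.2]

/-! ### The uniform law on the circle and its rotation invariance -/

theorem continuous_circlePoint : Continuous circlePoint :=
  Continuous.subtype_mk (continuous_circleMap 0 1) _

theorem circlePoint_periodic : Function.Periodic circlePoint (2 * Real.pi) := fun θ =>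
  Subtype.ext (periodic_circleMap 0 1 θ)

theorem exists_circlePoint_eq (x : UnitCircle) : ∃ θ, circlePoint θ = x := by
  refine ⟨Complex.arg x, Subtype.ext ?_⟩
  have := Complex.norm_mul_exp_arg_mul_I (x : ℂ)
  rw [mem_sphere_zero_iff_norm.1 x.2] at this
  simpa [circlePoint, circleMap] using this

theorem dist_circlePoint (a b : ℝ) :
    dist (circlePoint a) (circlePoint b) = 2 * |Real.sin ((a - b) / 2)| := by
  have h : circleMap 0 1 a - circleMap 0 1 b
      = circleMap 0 1 b * (Complex.exp (Complex.I * ((a - b : ℝ) : ℂ)) - 1) := by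
    simp only [circleMap, zero_add, Complex.ofReal_one, one_mul, mul_sub, mul_one,
      ← Complex.exp_add]
    congr 2
    push_cast
    ring
  rw [Subtype.dist_eq, dist_eq_norm]
  change ‖circleMap 0 1 a - circleMap 0 1 b‖ = _
  rw [h, norm_mul, Complex.norm_exp_I_mul_ofReal_sub_one]
  simp

/-- The uniform distribution of angles. -/
abbrev uniformAngle : Measure ℝ := cond (volume : Measure ℝ) (Set.Ioc 0 (2 * Real.pi))

instance : IsProbabilityMeasure uniformAngle :=
  cond_isProbabilityMeasure_of_finite (by simp [Real.pi_pos])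
    (by rw [Real.volume_Ioc]; exact ENNReal.ofReal_ne_top)

instance : IsProbabilityMeasure uniformCircle :=
  Measure.isProbabilityMeasure_map continuous_circlePoint.measurable.aemeasurable

theorem uniformCircle_eq_map : uniformCircle = uniformAngle.map circlePoint := rfl

theorem uniformAngle_eq : uniformAngle =
    ENNReal.ofReal (1 / (2 * Real.pi)) • volume.restrict (Set.Ioc 0 (2 * Real.pi)) := by
  rw [uniformAngle, ProbabilityTheory.cond, Real.volume_Ioc, sub_zero, one_div,
    ENNReal.ofReal_inv_of_pos (by positivity)]

/-- The uniform distribution on the circle is invariant under rotations. -/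
theorem uniformCircle_eq_map_add (θ : ℝ) :
    uniformCircle = uniformAngle.map (fun α => circlePoint (θ + α)) := by
  have hc : Continuous fun α => circlePoint (θ + α) :=
    continuous_circlePoint.comp (by fun_prop)
  ext E hE
  have hE' : MeasurableSet (circlePoint ⁻¹' E) := continuous_circlePoint.measurable hE
  rw [uniformCircle_eq_map, Measure.map_apply continuous_circlePoint.measurable hE,
    Measure.map_apply hc.measurable hE, uniformAngle_eq, Measure.smul_apply, Measure.smul_apply,
    Measure.restrict_apply hE', Measure.restrict_apply (hc.measurable hE)]
  congr 1
  -- `(0, 2π]` and `(θ, θ + 2π]` are fundamental domains of the same translation group, and the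
  -- preimage of `E` is invariant under it.
  have h1 := (isAddFundamentalDomain_Ioc Real.two_pi_pos 0).measure_set_eq
    (isAddFundamentalDomain_Ioc Real.two_pi_pos θ) (A := circlePoint ⁻¹' E) hE' (μ := volume) (by
      rintro ⟨g, hg⟩
      obtain ⟨k, rfl⟩ := AddSubgroup.mem_zmultiples_iff.1 hg
      ext x
      have := circlePoint_periodic.zsmul k x
      simp only [Set.mem_preimage, AddSubgroup.mk_vadd, vadd_eq_add]
      rw [add_comm, this])
  rw [zero_add] at h1
  rw [h1, ← measure_preimage_add volume θ (circlePoint ⁻¹' E ∩ _)]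
  congr 1
  ext α
  simp

theorem perimeter_circlePoint (θ α β : ℝ) :
    perimeter (circlePoint θ) (circlePoint (θ + α)) (circlePoint (θ + β))
      = 2 * (|Real.sin (α / 2)| + |Real.sin ((β - α) / 2)| + |Real.sin (β / 2)|) := by
  rw [perimeter, dist_circlePoint, dist_circlePoint, dist_circlePoint]
  have h1 : (θ - (θ + α)) / 2 = -(α / 2) := by ring
  have h2 : (θ + α - (θ + β)) / 2 = -((β - α) / 2) := by ring
  have h3 : (θ + β - θ) / 2 = β / 2 := by ring
  rw [h1, h2, h3, Real.sin_neg, Real.sin_neg, abs_neg, abs_neg]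
  ring

theorem continuous_perimeter : Continuous fun p : UnitCircle × UnitCircle × UnitCircle =>
    perimeter p.1 p.2.1 p.2.2 := by
  unfold perimeter
  fun_prop

theorem perimeter_rotate (x y z : UnitCircle) : perimeter x y z = perimeter y z x := by
  unfold perimeter; ring

theorem perimeter_swap (x y z : UnitCircle) : perimeter x y z = perimeter x z y := by
  unfold perimeter
  rw [dist_comm x y, dist_comm y z, dist_comm z x]
  ring

/-! ### Sides of almost maximal triangles -/

/-- The sides of an inscribed triangle of almost maximal perimeter are close to `√3`. -/
theorem sq_dist_sub_sqrt_three_le {x y z : UnitCircle} {s : ℝ}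
    (h : 3 * √3 - s ≤ perimeter x y z) : (dist x y - √3) ^ 2 ≤ 2 * √3 * s := by
  -- The sum of the squared sides equals `9 - ‖x + y + z‖²`.
  have key : dist x y ^ 2 + dist y z ^ 2 + dist z x ^ 2 ≤ 9 := by
    have hx := mem_sphere_zero_iff_norm.1 x.2
    have hy := mem_sphere_zero_iff_norm.1 y.2
    have hz := mem_sphere_zero_iff_norm.1 z.2
    simp only [Subtype.dist_eq, dist_eq_norm]
    rw [← sq_eq_sq₀ (norm_nonneg _) zero_le_one, Complex.sq_norm, Complex.normSq_apply] at hx hy hz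
    simp only [Complex.sq_norm, Complex.normSq_apply, Complex.sub_re, Complex.sub_im]
    nlinarith [sq_nonneg ((x : ℂ).re + (y : ℂ).re + (z : ℂ).re),
      sq_nonneg ((x : ℂ).im + (y : ℂ).im + (z : ℂ).im)]
  unfold perimeter at h
  have h3 : √3 ^ 2 = 3 := Real.sq_sqrt (by norm_num)
  have h0 := Real.sqrt_nonneg 3
  have := mul_le_mul_of_nonneg_left h h0
  -- Summing `(side - √3)²` over the three sides gives at most `18 - 2√3 (3√3 - s) = 2√3 s`.
  nlinarith [sq_nonneg (dist y z - √3), sq_nonneg (dist z x - √3)]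

/-- The product `sin (b - π/3) sin (b + π/3)` equals `sin² b - 3/4`, and its second factor is at
least `1/2` on this range. Jordan's inequality then turns the bound on `|sin (b - π/3)|` into one on
the angle. -/
theorem abs_le_of_abs_two_mul_sin_sub_le {b δ : ℝ} (h0 : 0 ≤ b) (h1 : b ≤ Real.pi / 2)
    (h : |2 * Real.sin b - √3| ≤ δ) : |b - Real.pi / 3| ≤ Real.pi * δ := by
  have hpi := Real.pi_pos
  have hs : Real.sin (b - Real.pi / 3) * Real.sin (b + Real.pi / 3)
      = (2 * Real.sin b - √3) * (2 * Real.sin b + √3) / 4 := by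
    rw [Real.sin_sub, Real.sin_add, Real.sin_pi_div_three, Real.cos_pi_div_three]
    have h3 : √3 ^ 2 = 3 := Real.sq_sqrt (by norm_num)
    have := Real.sin_sq_add_cos_sq b
    linear_combination (1 / 4) * h3 - (3 / 4) * this - (1 / 4) * Real.cos b ^ 2 * h3
  have hhalf : 1 / 2 ≤ Real.sin (b + Real.pi / 3) := by
    rw [← Real.cos_pi_div_three, ← Real.cos_pi_div_two_sub,
      ← Real.cos_abs (Real.pi / 2 - (b + Real.pi / 3))]
    refine Real.cos_le_cos_of_nonneg_of_le_pi (abs_nonneg _) (by linarith) ?_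
    rw [abs_le]
    constructor <;> linarith
  have hj := Real.mul_abs_le_abs_sin (x := b - Real.pi / 3) (by
    rw [abs_le]
    constructor <;> linarith)
  have hsq : √3 ≤ 2 := by
    rw [Real.sqrt_le_left (by norm_num)]
    norm_num
  have hb1 := Real.sin_le_one b
  have hb0 := Real.sin_nonneg_of_nonneg_of_le_pi h0 (by linarith)
  have hδ : 0 ≤ δ := (abs_nonneg _).trans h
  have e1 : |Real.sin (b - Real.pi / 3)| * (1 / 2) ≤ δ := by
    calc |Real.sin (b - Real.pi / 3)| * (1 / 2)
        ≤ |Real.sin (b - Real.pi / 3)| * |Real.sin (b + Real.pi / 3)| := by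
          gcongr
          exact hhalf.trans (le_abs_self _)
      _ = |2 * Real.sin b - √3| * (2 * Real.sin b + √3) / 4 := by
          rw [← abs_mul, hs, abs_div, abs_mul,
            abs_of_nonneg (a := 2 * Real.sin b + √3) (by positivity)]
          norm_num
      _ ≤ δ * 4 / 4 := by
          gcongr
          linarith
      _ = δ := by ring
  have e2 : 2 / Real.pi * |b - Real.pi / 3| ≤ 2 * δ := by linarith
  rw [div_mul_eq_mul_div, div_le_iff₀ hpi] at e2
  linarith

/-- The points at distance almost `√3` from a given point lie in two short arcs. -/
theorem uniformCircle_near_le (x : UnitCircle) {δ : ℝ} (hδ : 0 ≤ δ) :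
    uniformCircle {y | |dist x y - √3| ≤ δ} ≤ ENNReal.ofReal (4 * δ) := by
  obtain ⟨θ, rfl⟩ := exists_circlePoint_eq x
  have hpi := Real.pi_pos
  have hc : Continuous fun α => circlePoint (θ + α) :=
    continuous_circlePoint.comp (by fun_prop)
  have hm : MeasurableSet {y | |dist (circlePoint θ) y - √3| ≤ δ} :=
    measurableSet_le (by fun_prop) (by fun_prop)
  rw [uniformCircle_eq_map_add θ, Measure.map_apply hc.measurable hm, uniformAngle_eq,
    Measure.smul_apply, Measure.restrict_apply (hc.measurable hm), smul_eq_mul]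
  -- The chord is `2 sin (α / 2)`, so `α / 2` is within `πδ` of `π/3` or of `2π/3`. Two arcs of
  -- length `4πδ` have normalized measure `4δ`.
  have hsub : (fun α => circlePoint (θ + α)) ⁻¹' {y | |dist (circlePoint θ) y - √3| ≤ δ} ∩
      Set.Ioc 0 (2 * Real.pi) ⊆ Metric.closedBall (2 * Real.pi / 3) (2 * Real.pi * δ) ∪
        Metric.closedBall (4 * Real.pi / 3) (2 * Real.pi * δ) := by
    rintro α ⟨h, h0, h1⟩
    simp only [Set.mem_preimage, Set.mem_ofPred_eq, dist_circlePoint] at h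
    have h2 : (θ - (θ + α)) / 2 = -(α / 2) := by ring
    rw [h2, Real.sin_neg, abs_neg,
      abs_of_nonneg (Real.sin_nonneg_of_nonneg_of_le_pi (by linarith) (by linarith))] at h
    simp only [Set.mem_union, Metric.mem_closedBall, Real.dist_eq]
    rcases le_total (α / 2) (Real.pi / 2) with h3 | h3
    · left
      have := abs_le_of_abs_two_mul_sin_sub_le (by linarith) h3 h
      rw [abs_le] at this ⊢
      constructor <;> linarith
    · right
      rw [← Real.sin_pi_sub] at h
      have := abs_le_of_abs_two_mul_sin_sub_le (by linarith) (by linarith) h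
      rw [abs_le] at this ⊢
      constructor <;> linarith
  calc ENNReal.ofReal (1 / (2 * Real.pi)) * volume _
      ≤ ENNReal.ofReal (1 / (2 * Real.pi)) * (ENNReal.ofReal (2 * (2 * Real.pi * δ))
        + ENNReal.ofReal (2 * (2 * Real.pi * δ))) := by
        gcongr
        refine (measure_mono hsub).trans ((measure_union_le _ _).trans ?_)
        rw [Real.volume_closedBall, Real.volume_closedBall]
    _ = ENNReal.ofReal (4 * δ) := by
        rw [← ENNReal.ofReal_add (by positivity) (by positivity),
          ← ENNReal.ofReal_mul (by positivity)]
        congr 1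
        field_simp
        ring

/-! ### Area of the limiting ellipse -/

theorem volume_disc (R : ℝ) (hR : 0 ≤ R) :
    volume {p : ℝ × ℝ | p.1 ^ 2 + p.2 ^ 2 ≤ R} = ENNReal.ofReal (Real.pi * R) := by
  have hm : MeasurableSet {p : ℝ × ℝ | p.1 ^ 2 + p.2 ^ 2 ≤ R} :=
    measurableSet_le (by fun_prop) (by fun_prop)
  rw [← Complex.volume_preserving_equiv_real_prod.measure_preimage hm.nullMeasurableSet]
  have : Complex.measurableEquivRealProd ⁻¹' {p : ℝ × ℝ | p.1 ^ 2 + p.2 ^ 2 ≤ R}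
      = Metric.closedBall 0 (√R) := by
    ext z
    rw [mem_closedBall_zero_iff, Real.le_sqrt (norm_nonneg _) hR, Complex.sq_norm,
      Complex.normSq_apply]
    simp [Complex.measurableEquivRealProd_apply, sq]
  rw [this, Complex.volume_closedBall, ← ENNReal.ofReal_pow (Real.sqrt_nonneg _), Real.sq_sqrt hR,
    mul_comm Real.pi, ENNReal.ofReal_mul hR]
  congr 1
  rw [← NNReal.coe_real_pi, ENNReal.ofReal_coe_nnreal]

/-- Completing the square, `u² - uv + v² = (u - v/2)² + (√3 v/2)²`, so a linear map of determinant
`√3/2` carries the ellipse to a disc. Negative `R` is allowed because the radius `s - 8 s √s` used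
later may be negative. -/
theorem volume_ellipse (a b R : ℝ) :
    volume {p : ℝ × ℝ | (p.1 - a) ^ 2 - (p.1 - a) * (p.2 - b) + (p.2 - b) ^ 2 ≤ R}
      = ENNReal.ofReal (2 * Real.pi * R / √3) := by
  have h3 : √3 ^ 2 = 3 := Real.sq_sqrt (by norm_num)
  have h3pos : 0 < √3 := by positivity
  rcases lt_or_ge R 0 with hR | hR
  · have : {p : ℝ × ℝ | (p.1 - a) ^ 2 - (p.1 - a) * (p.2 - b) + (p.2 - b) ^ 2 ≤ R} = ∅ := by
      ext p
      simp only [Set.mem_ofPred_eq, Set.mem_empty_iff_false, iff_false, not_le]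
      nlinarith [sq_nonneg ((p.1 - a) - (p.2 - b) / 2), sq_nonneg (p.2 - b)]
    rw [this, measure_empty, ENNReal.ofReal_of_nonpos]
    exact div_nonpos_of_nonpos_of_nonneg (by nlinarith [Real.pi_pos]) h3pos.le
  let L : ℝ × ℝ →ₗ[ℝ] ℝ × ℝ :=
    Matrix.toLin (Module.Basis.finTwoProd ℝ) (Module.Basis.finTwoProd ℝ) !![1, -1 / 2; 0, √3 / 2]
  have hdet : LinearMap.det L = √3 / 2 := by
    rw [LinearMap.det_toLin, Matrix.det_fin_two_of]
    ring
  have hpre : {p : ℝ × ℝ | (p.1 - a) ^ 2 - (p.1 - a) * (p.2 - b) + (p.2 - b) ^ 2 ≤ R}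
      = (fun p => p + (-a, -b)) ⁻¹' (L ⁻¹' {p : ℝ × ℝ | p.1 ^ 2 + p.2 ^ 2 ≤ R}) := by
    ext p
    simp only [Set.mem_ofPred_eq, Set.mem_preimage, L, Matrix.toLin_finTwoProd_apply,
      Prod.fst_add, Prod.snd_add]
    rw [show (1 * (p.1 + -a) + -1 / 2 * (p.2 + -b)) ^ 2 + (0 * (p.1 + -a) + √3 / 2 * (p.2 + -b)) ^ 2
      = (p.1 - a) ^ 2 - (p.1 - a) * (p.2 - b) + (p.2 - b) ^ 2 by
        linear_combination (p.2 - b) ^ 2 / 4 * h3]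
  rw [hpre, measure_preimage_add_right,
    Measure.addHaar_preimage_linearMap volume (by rw [hdet]; positivity), hdet,
    volume_disc R hR, ← ENNReal.ofReal_mul (by positivity), abs_of_pos (by positivity)]
  congr 1
  field_simp

/-! ### Expansion of the perimeter deficit at the equilateral triangle -/

/-- The gap between `sin` and its tangent at `π / 3`. -/
def sinGap (u : ℝ) : ℝ := √3 / 2 + u / 2 - Real.sin (Real.pi / 3 + u)

theorem sinGap_eq (u : ℝ) : sinGap u = √3 / 2 * (1 - Real.cos u) + (u - Real.sin u) / 2 := by
  rw [sinGap, Real.sin_add, Real.sin_pi_div_three, Real.cos_pi_div_three]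
  ring

/-- The range is that of a half-arc in `[0, π]` minus `π/3`, so this global bound localizes almost
maximal triangles near the equilateral one. The cosine term of `sinGap_eq` gives at least `0.173
u²`; for negative `u` the sine term costs at most `1.05/12 u²`. -/
theorem mul_sq_le_sinGap {u : ℝ} (h0 : -(Real.pi / 3) ≤ u) (h1 : u ≤ 2 * Real.pi / 3) :
    2 / 25 * u ^ 2 ≤ sinGap u := by
  have hpi := Real.pi_pos
  have hpi1 := Real.pi_lt_d2
  have h3 : (1.73 : ℝ) ≤ √3 := by
    rw [Real.le_sqrt (by norm_num) (by norm_num)]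
    norm_num
  have hcos := Real.cos_le_one_sub_mul_cos_sq (x := u) (by
    rw [abs_le]
    constructor <;> linarith)
  have hk : (1 / 5 : ℝ) ≤ 2 / Real.pi ^ 2 := by
    rw [div_le_div_iff₀ (by norm_num) (by positivity)]
    nlinarith
  have hcos' : 1 / 5 * u ^ 2 ≤ 1 - Real.cos u := by
    nlinarith [mul_le_mul_of_nonneg_right hk (sq_nonneg u)]
  have hmain : 1.73 / 2 * (1 / 5 * u ^ 2) ≤ √3 / 2 * (1 - Real.cos u) :=
    mul_le_mul (by linarith) hcos' (by positivity) (by positivity)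
  rw [sinGap_eq]
  rcases le_total 0 u with hu | hu
  · have := Real.sin_le hu
    nlinarith [sq_nonneg u]
  · have hs : -u - (-u) ^ 3 / 6 ≤ Real.sin (-u) := by
      rcases hu.eq_or_lt with rfl | hu
      · simp
      · exact (Real.sin_gt_sub_cube (by linarith)).le
    rw [Real.sin_neg] at hs
    have : (-u) * u ^ 2 ≤ 1.05 * u ^ 2 :=
      mul_le_mul_of_nonneg_right (by linarith) (sq_nonneg u)
    nlinarith [sq_nonneg u]

theorem abs_sinGap_sub_le {u : ℝ} (hu : |u| ≤ 1) : |sinGap u - √3 / 4 * u ^ 2| ≤ |u| ^ 3 / 4 := by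
  have h3 : √3 ≤ 2 := by
    rw [Real.sqrt_le_left (by norm_num)]
    norm_num
  have hc := Real.cos_bound hu
  have hs := Real.sin_bound hu
  have h4 : |u| ^ 4 ≤ |u| ^ 3 := pow_le_pow_of_le_one (abs_nonneg _) hu (by norm_num)
  have h5 : |u| ^ 5 ≤ |u| ^ 3 := pow_le_pow_of_le_one (abs_nonneg _) hu (by norm_num)
  have e : sinGap u - √3 / 4 * u ^ 2 = -(√3 / 2) * (Real.cos u - (1 - u ^ 2 / 2))
      - (Real.sin u - (u - u ^ 3 / 6)) / 2 + u ^ 3 / 12 := by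
    rw [sinGap_eq]
    ring
  have c1 : |-(√3 / 2) * (Real.cos u - (1 - u ^ 2 / 2))| ≤ 1 * (|u| ^ 4 * (5 / 96)) := by
    rw [abs_mul, abs_neg, abs_of_nonneg (by positivity)]
    exact mul_le_mul (by linarith) hc (abs_nonneg _) zero_le_one
  have c2 : |u ^ 3 / 12| = |u| ^ 3 / 12 := by
    rw [abs_div, abs_pow]
    norm_num
  have c3 : |(Real.sin u - (u - u ^ 3 / 6)) / 2| = |Real.sin u - (u - u ^ 3 / 6)| / 2 := by
    rw [abs_div]
    norm_num
  rw [e]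
  have t1 := abs_add_le (-(√3 / 2) * (Real.cos u - (1 - u ^ 2 / 2))
    - (Real.sin u - (u - u ^ 3 / 6)) / 2) (u ^ 3 / 12)
  have t2 := abs_sub (-(√3 / 2) * (Real.cos u - (1 - u ^ 2 / 2)))
    ((Real.sin u - (u - u ^ 3 / 6)) / 2)
  have : 0 ≤ |u| ^ 3 := by positivity
  linarith

/-- The perimeter of the inscribed triangle whose vertices have the angles `0`, `p.1`, `p.2`. -/
def anglePerimeter (p : ℝ × ℝ) : ℝ :=
  2 * (|Real.sin (p.1 / 2)| + |Real.sin ((p.2 - p.1) / 2)| + |Real.sin (p.2 / 2)|)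

theorem continuous_anglePerimeter : Continuous anglePerimeter := by
  unfold anglePerimeter
  fun_prop

theorem anglePerimeter_swap (p : ℝ × ℝ) : anglePerimeter p.swap = anglePerimeter p := by
  have h : (p.1 - p.2) / 2 = -((p.2 - p.1) / 2) := by ring
  simp only [anglePerimeter, Prod.fst_swap, Prod.snd_swap, h, Real.sin_neg, abs_neg]
  ring

/-- The half-arcs `p.1 / 2`, `(p.2 - p.1) / 2` and `π - p.2 / 2` add up to `π`, so the tangent-line
terms in the three gaps cancel. -/
theorem three_sqrt_three_sub_anglePerimeter {p : ℝ × ℝ} (h0 : 0 ≤ p.1) (h1 : p.1 ≤ p.2)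
    (h2 : p.2 ≤ 2 * Real.pi) :
    3 * √3 - anglePerimeter p = 2 * (sinGap (p.1 / 2 - Real.pi / 3)
      + sinGap ((p.2 - p.1) / 2 - Real.pi / 3) + sinGap (2 * Real.pi / 3 - p.2 / 2)) := by
  rw [anglePerimeter, abs_of_nonneg, abs_of_nonneg, abs_of_nonneg, sinGap, sinGap, sinGap,
    ← Real.sin_pi_sub (p.2 / 2)]
  · ring_nf
  all_goals exact Real.sin_nonneg_of_nonneg_of_le_pi (by linarith) (by linarith)

theorem abs_sum_sinGap_sub_le {u v w r : ℝ} (hr : r ≤ 1) (hu : |u| ≤ r) (hv : |v| ≤ r)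
    (hw : |w| ≤ r) :
    |2 * (sinGap u + sinGap v + sinGap w) - √3 / 2 * (u ^ 2 + v ^ 2 + w ^ 2)|
      ≤ r * (u ^ 2 + v ^ 2 + w ^ 2) / 2 := by
  have key : ∀ {x : ℝ}, |x| ≤ r → |sinGap x - √3 / 4 * x ^ 2| ≤ r * x ^ 2 / 4 := fun {x} hx => by
    refine (abs_sinGap_sub_le (hx.trans hr)).trans ?_
    rw [pow_succ', ← sq_abs x]
    gcongr
  have ku := abs_le.1 (key hu)
  have kv := abs_le.1 (key hv)
  have kw := abs_le.1 (key hw)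
  rw [abs_le]
  constructor <;> linarith [ku.1, ku.2, kv.1, kv.2, kw.1, kw.2]

/-- The constant `25/4` is what `mul_sq_le_sinGap` yields: a deficit of at most `s` forces `2 ·
(2/25) (u² + v² + w²) ≤ s`. -/
theorem abs_le_of_sum_sq_le {u v w s : ℝ} (h : u ^ 2 + v ^ 2 + w ^ 2 ≤ 25 / 4 * s) :
    |u| ≤ 5 / 2 * √s ∧ |v| ≤ 5 / 2 * √s ∧ |w| ≤ 5 / 2 * √s := by
  have hs : 0 ≤ s := by nlinarith [sq_nonneg u, sq_nonneg v, sq_nonneg w]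
  have h1 : (5 / 2 * √s) ^ 2 = 25 / 4 * s := by
    rw [mul_pow, Real.sq_sqrt hs]
    norm_num
  refine ⟨?_, ?_, ?_⟩ <;>
  · refine abs_le.2 (abs_le_of_sq_le_sq' ?_ (by positivity))
    rw [h1]
    nlinarith [sq_nonneg u, sq_nonneg v, sq_nonneg w]

theorem sqrt_le_of_le_four_div {s : ℝ} (hs : s ≤ 4 / 25) : 5 / 2 * √s ≤ 1 := by
  have : √s ≤ 2 / 5 := by
    rw [Real.sqrt_le_left (by norm_num)]
    linarith
  linarith

/-! ### Probability that a triangle is almost maximal -/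

/-- The angles of the almost maximal triangles, in increasing order. -/
def goodAngles (s : ℝ) : Set (ℝ × ℝ) :=
  {p | 0 < p.1 ∧ p.1 < p.2 ∧ p.2 ≤ 2 * Real.pi ∧ 3 * √3 - s ≤ anglePerimeter p}

/-- The ellipses that approximate `goodAngles`. -/
def angleEllipse (R : ℝ) : Set (ℝ × ℝ) :=
  {p | (p.1 - 2 * Real.pi / 3) ^ 2 - (p.1 - 2 * Real.pi / 3) * (p.2 - 4 * Real.pi / 3)
    + (p.2 - 4 * Real.pi / 3) ^ 2 ≤ 4 * R / √3}

theorem mem_angleEllipse {p : ℝ × ℝ} {R : ℝ} : p ∈ angleEllipse R ↔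
    √3 / 2 * ((p.1 / 2 - Real.pi / 3) ^ 2 + ((p.2 - p.1) / 2 - Real.pi / 3) ^ 2
      + (2 * Real.pi / 3 - p.2 / 2) ^ 2) ≤ R := by
  have h3 : 0 < √3 := by positivity
  rw [angleEllipse, Set.mem_ofPred_eq, le_div_iff₀ h3]
  constructor <;> intro h <;> linarith

theorem volume_angleEllipse (R : ℝ) :
    volume (angleEllipse R) = ENNReal.ofReal (8 * Real.pi * R / 3) := by
  rw [angleEllipse, volume_ellipse]
  have h3 : √3 ^ 2 = 3 := Real.sq_sqrt (by norm_num)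
  congr 1
  field_simp
  rw [h3]
  ring

/-- The quadratic lower bound confines the deviations to `5/2 √s ≤ 1`, where the cubic Taylor error
applies. It is at most `5/2 √s · 25/4 s / 2 = 125/16 s √s`, whence the `8`. -/
theorem goodAngles_subset {s : ℝ} (hs : s ≤ 4 / 25) :
    goodAngles s ⊆ angleEllipse (s + 8 * (s * √s)) := by
  rintro p ⟨h0, h1, h2, h⟩
  have hD := three_sqrt_three_sub_anglePerimeter h0.le h1.le h2
  rw [mem_angleEllipse]
  set u := p.1 / 2 - Real.pi / 3 with hu
  set v := (p.2 - p.1) / 2 - Real.pi / 3 with hv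
  set w := 2 * Real.pi / 3 - p.2 / 2 with hw
  have lu := mul_sq_le_sinGap (u := u) (by linarith) (by linarith)
  have lv := mul_sq_le_sinGap (u := v) (by linarith) (by linarith)
  have lw := mul_sq_le_sinGap (u := w) (by linarith) (by linarith)
  have hsum : u ^ 2 + v ^ 2 + w ^ 2 ≤ 25 / 4 * s := by linarith
  obtain ⟨bu, bv, bw⟩ := abs_le_of_sum_sq_le hsum
  have := (abs_le.1 (abs_sum_sinGap_sub_le (sqrt_le_of_le_four_div hs) bu bv bw)).1
  have h4 := mul_le_mul_of_nonneg_left hsum (by positivity : 0 ≤ 5 / 2 * √s)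
  have h5 : 0 ≤ s * √s := mul_nonneg (by nlinarith [sq_nonneg u, sq_nonneg v, sq_nonneg w])
    (Real.sqrt_nonneg _)
  linarith

theorem subset_goodAngles {s : ℝ} (hs0 : 0 ≤ s) (hs : s ≤ 4 / 25) :
    angleEllipse (s - 8 * (s * √s)) ⊆ goodAngles s := by
  intro p hp
  rw [mem_angleEllipse] at hp
  set u := p.1 / 2 - Real.pi / 3 with hu
  set v := (p.2 - p.1) / 2 - Real.pi / 3 with hv
  set w := 2 * Real.pi / 3 - p.2 / 2 with hw
  have h3 : (1 : ℝ) ≤ √3 := by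
    rw [Real.one_le_sqrt]
    norm_num
  have h5 : 0 ≤ s * √s := by positivity
  have hsum : u ^ 2 + v ^ 2 + w ^ 2 ≤ 25 / 4 * s := by
    nlinarith [mul_le_mul_of_nonneg_right h3 (by positivity : 0 ≤ u ^ 2 + v ^ 2 + w ^ 2)]
  obtain ⟨bu, bv, bw⟩ := abs_le_of_sum_sq_le hsum
  have hr := sqrt_le_of_le_four_div hs
  have := (abs_le.1 (abs_sum_sinGap_sub_le hr bu bv bw)).2
  have h4 := mul_le_mul_of_nonneg_left hsum (by positivity : 0 ≤ 5 / 2 * √s)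
  have hpi := Real.pi_gt_three
  have cu := abs_le.1 (bu.trans hr)
  have cv := abs_le.1 (bv.trans hr)
  have cw := abs_le.1 (bw.trans hr)
  -- Deviations of at most `1 < π/3` keep all three arcs positive, so the angles are in the required
  -- order.
  have g0 : 0 < p.1 := by linarith [cu.1]
  have g1 : p.1 < p.2 := by linarith [cv.1]
  have g2 : p.2 ≤ 2 * Real.pi := by linarith [cw.1]
  have hD := three_sqrt_three_sub_anglePerimeter g0.le g1.le g2
  exact ⟨g0, g1, g2, by linarith⟩

/-- The probability that a triangle with one given and two uniformly distributed vertices has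
perimeter at least `3 √3 - s`. -/
def goodProb (s : ℝ) : ENNReal :=
  (uniformAngle.prod uniformAngle) {p | 3 * √3 - s ≤ anglePerimeter p}

theorem goodProb_eq (x : UnitCircle) (s : ℝ) :
    (uniformCircle.prod uniformCircle) {p | 3 * √3 - s ≤ perimeter x p.1 p.2} = goodProb s := by
  obtain ⟨θ, rfl⟩ := exists_circlePoint_eq x
  have hc : Continuous fun α => circlePoint (θ + α) :=
    continuous_circlePoint.comp (by fun_prop)
  have hp : Continuous fun p : UnitCircle × UnitCircle => perimeter (circlePoint θ) p.1 p.2 :=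
    continuous_perimeter.comp (by fun_prop : Continuous fun p : UnitCircle × UnitCircle =>
      (circlePoint θ, p.1, p.2))
  rw [uniformCircle_eq_map_add θ, Measure.map_prod_map _ _ hc.measurable hc.measurable,
    Measure.map_apply (by fun_prop) (measurableSet_le measurable_const hp.measurable)]
  refine congrArg _ (Set.ext fun p => ?_)
  simp only [Set.mem_preimage, Set.mem_ofPred_eq, Prod.map_fst, Prod.map_snd]
  rw [perimeter_circlePoint]
  rfl

theorem goodProb_eq_volume {s : ℝ} (hs : s ≤ 4 / 25) :
    goodProb s = ENNReal.ofReal (1 / (2 * Real.pi)) ^ 2 * (2 * volume (goodAngles s)) := by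
  have hm : MeasurableSet {p | 3 * √3 - s ≤ anglePerimeter p} :=
    measurableSet_le measurable_const continuous_anglePerimeter.measurable
  have hg : MeasurableSet (goodAngles s) := by
    refine (measurableSet_lt measurable_const measurable_fst).inter
      ((measurableSet_lt measurable_fst measurable_snd).inter
      ((measurableSet_le measurable_snd measurable_const).inter hm))
  have hsplit : {p | 3 * √3 - s ≤ anglePerimeter p} ∩
      Set.Ioc 0 (2 * Real.pi) ×ˢ Set.Ioc 0 (2 * Real.pi)
        = goodAngles s ∪ Prod.swap ⁻¹' goodAngles s := by
    ext p
    simp only [goodAngles, Set.mem_inter_iff, Set.mem_union, Set.mem_ofPred_eq, Set.mem_prod,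
      Set.mem_Ioc, Set.mem_preimage, anglePerimeter_swap, Prod.fst_swap, Prod.snd_swap]
    constructor
    · rintro ⟨h, ⟨a0, a1⟩, b0, b1⟩
      rcases lt_trichotomy p.1 p.2 with hlt | heq | hgt
      · exact Or.inl ⟨a0, hlt, b1, h⟩
      -- A degenerate triangle has perimeter at most `4`, which is below `3√3 - 4/25`.
      · exfalso
        have h3 : (1.73 : ℝ) ≤ √3 := by
          rw [Real.le_sqrt (by norm_num) (by norm_num)]
          norm_num
        have h4 := Real.abs_sin_le_one (p.2 / 2)
        rw [anglePerimeter, heq, sub_self, zero_div, Real.sin_zero, abs_zero] at h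
        linarith
      · exact Or.inr ⟨b0, hgt, a1, h⟩
    · rintro (⟨a, b, c, d⟩ | ⟨a, b, c, d⟩)
      · exact ⟨d, ⟨a, by linarith⟩, by linarith, c⟩
      · exact ⟨d, ⟨by linarith, c⟩, a, by linarith⟩
  have hdisj : Disjoint (goodAngles s) (Prod.swap ⁻¹' goodAngles s) := by
    rw [Set.disjoint_left]
    rintro p ⟨-, h1, -⟩ ⟨-, h2, -⟩
    exact lt_asymm h1 h2
  have hswap : volume (Prod.swap ⁻¹' goodAngles s) = volume (goodAngles s) :=
    (Measure.measurePreserving_swap (μ := (volume : Measure ℝ)) (ν := (volume : Measure ℝ))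
      ).measure_preimage hg.nullMeasurableSet
  rw [goodProb, uniformAngle_eq, Measure.prod_smul_left, Measure.prod_smul_right,
    Measure.prod_restrict, Measure.smul_apply, Measure.smul_apply, Measure.restrict_apply hm, hsplit,
    ← Measure.volume_eq_prod, measure_union hdisj (hg.preimage measurable_swap), hswap]
  simp only [smul_eq_mul]
  ring

theorem abs_goodProb_sub_le {s : ℝ} (hs0 : 0 ≤ s) (hs : s ≤ 4 / 25) :
    |(goodProb s).toReal - 4 * s / (3 * Real.pi)| ≤ 4 * (s * √s) := by
  have hpi := Real.pi_gt_three
  have h5 : 0 ≤ s * √s := by positivity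
  have hup := measure_mono (μ := volume) (goodAngles_subset hs)
  have hlo := measure_mono (μ := volume) (subset_goodAngles hs0 hs)
  rw [volume_angleEllipse] at hup hlo
  have hfin : volume (goodAngles s) ≠ ⊤ := ne_top_of_le_ne_top ENNReal.ofReal_ne_top hup
  rw [← ENNReal.ofReal_toReal hfin] at hup hlo
  have hup' := (ENNReal.ofReal_le_ofReal_iff (by positivity)).1 hup
  have hlo' := (ENNReal.ofReal_le_ofReal_iff ENNReal.toReal_nonneg).1 hlo
  rw [goodProb_eq_volume hs, ENNReal.toReal_mul, ENNReal.toReal_mul, ENNReal.toReal_pow,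
    ENNReal.toReal_ofReal (by positivity), ENNReal.toReal_ofNat]
  set V := (volume (goodAngles s)).toReal
  have hV : |V - 8 * Real.pi * s / 3| ≤ 64 * Real.pi / 3 * (s * √s) := by
    rw [abs_le]
    constructor <;> linarith
  have e : (1 / (2 * Real.pi)) ^ 2 * (2 * V) - 4 * s / (3 * Real.pi)
      = (V - 8 * Real.pi * s / 3) * (1 / (2 * Real.pi ^ 2)) := by
    field_simp
    ring
  rw [e, abs_mul, abs_of_pos (a := 1 / (2 * Real.pi ^ 2)) (by positivity)]
  calc _ ≤ 64 * Real.pi / 3 * (s * √s) * (1 / (2 * Real.pi ^ 2)) := by gcongr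
    _ = 32 / (3 * Real.pi) * (s * √s) := by
      field_simp
      ring
    _ ≤ 4 * (s * √s) := by
      gcongr
      rw [div_le_iff₀ (by positivity)]
      linarith

/-! ### Independence over disjoint index sets -/

/-- The `σ`-algebra generated by the variables `X i`, `i ∈ S`. -/
abbrev sigmaOn {Ω ι β : Type*} [mβ : MeasurableSpace β] (X : ι → Ω → β) (S : Set ι) :
    MeasurableSpace Ω :=
  ⨆ i ∈ S, mβ.comap (X i)

theorem measurable_sigmaOn {Ω ι β : Type*} [mβ : MeasurableSpace β] (X : ι → Ω → β) {S : Set ι}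
    {i : ι} (hi : i ∈ S) : Measurable[sigmaOn X S] (X i) :=
  measurable_iff_comap_le.2 (le_iSup₂ (f := fun i (_ : i ∈ S) => mβ.comap (X i)) i hi)

theorem sigmaOn_le {Ω ι β : Type*} [mΩ : MeasurableSpace Ω] [MeasurableSpace β] {X : ι → Ω → β}
    (hX : ∀ i, Measurable (X i)) (S : Set ι) : sigmaOn X S ≤ mΩ :=
  iSup₂_le fun i _ => (hX i).comap_le

theorem indepFun_of_measurable_sigmaOn {Ω ι β γ δ : Type*} [MeasurableSpace Ω] {P : Measure Ω}
    [MeasurableSpace β] [MeasurableSpace γ] [MeasurableSpace δ] {X : ι → Ω → β}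
    (hX : ∀ i, Measurable (X i)) (hind : iIndepFun X P) {S T : Set ι} (hST : Disjoint S T)
    {Y : Ω → γ} {Z : Ω → δ} (hY : Measurable[sigmaOn X S] Y) (hZ : Measurable[sigmaOn X T] Z) :
    IndepFun Y Z P := by
  have := indep_iSup_of_disjoint (fun i => (hX i).comap_le) hind hST
  rw [IndepFun_iff_Indep]
  exact indep_of_indep_of_le_left (indep_of_indep_of_le_right this hZ.comap_le) hY.comap_le

/-- The event that the triangle of the points with indices in `s` has perimeter at least `c`. -/
def goodEvent {Ω : Type*} (U : ℕ → Ω → UnitCircle) (c : ℝ) (s : Finset ℕ) : Set Ω :=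
  {ω | ∃ i ∈ s, ∃ j ∈ s, ∃ l ∈ s, i < j ∧ j < l ∧ c ≤ perimeter (U i ω) (U j ω) (U l ω)}

theorem goodEvent_triple {Ω : Type*} (U : ℕ → Ω → UnitCircle) (c : ℝ) {i j l : ℕ}
    (hij : i ≠ j) (hil : i ≠ l) (hjl : j ≠ l) :
    goodEvent U c {i, j, l} = {ω | c ≤ perimeter (U i ω) (U j ω) (U l ω)} := by
  ext ω
  have e1 := perimeter_rotate (U i ω) (U j ω) (U l ω)
  have e2 := perimeter_rotate (U j ω) (U l ω) (U i ω)
  have e3 := perimeter_swap (U i ω) (U j ω) (U l ω)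
  have e4 := perimeter_swap (U j ω) (U l ω) (U i ω)
  have e5 := perimeter_swap (U l ω) (U i ω) (U j ω)
  constructor
  · rintro ⟨a, ha, b, hb, d, hd, h1, h2, h⟩
    simp only [Finset.mem_insert, Finset.mem_singleton] at ha hb hd
    simp only [Set.mem_ofPred_eq]
    rcases ha with rfl | rfl | rfl <;> rcases hb with rfl | rfl | rfl <;>
      first
      | exact absurd h1 (lt_irrefl _)
      | (rcases hd with rfl | rfl | rfl <;>
          first
          | exact absurd h2 (lt_irrefl _)
          | exact absurd h1 (lt_asymm h2)
          | linarith)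
  · intro h
    simp only [Set.mem_ofPred_eq] at h
    have mi : i ∈ ({i, j, l} : Finset ℕ) := by simp
    have mj : j ∈ ({i, j, l} : Finset ℕ) := by simp
    have ml : l ∈ ({i, j, l} : Finset ℕ) := by simp
    rcases lt_or_gt_of_ne hij with h1 | h1 <;> rcases lt_or_gt_of_ne hil with h2 | h2 <;>
      rcases lt_or_gt_of_ne hjl with h3 | h3
    · exact ⟨i, mi, j, mj, l, ml, h1, h3, h⟩
    · exact ⟨i, mi, l, ml, j, mj, h2, h3, by linarith⟩
    · omega
    · exact ⟨l, ml, i, mi, j, mj, h2, h1, by linarith⟩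
    · exact ⟨j, mj, i, mi, l, ml, h1, h2, by linarith⟩
    · omega
    · exact ⟨j, mj, l, ml, i, mi, h3, h2, by linarith⟩
    · exact ⟨l, ml, j, mj, i, mi, h3, h1, by linarith⟩

theorem measurableSet_goodEvent {Ω : Type*} (U : ℕ → Ω → UnitCircle) (c : ℝ) (s : Finset ℕ)
    {T : Set ℕ} (hT : ↑s ⊆ T) : MeasurableSet[sigmaOn U T] (goodEvent U c s) := by
  have : goodEvent U c s = ⋃ i ∈ s, ⋃ j ∈ s, ⋃ l ∈ s,
      {ω | i < j ∧ j < l ∧ c ≤ perimeter (U i ω) (U j ω) (U l ω)} := by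
    ext ω
    simp only [goodEvent, Set.mem_iUnion, Set.mem_ofPred_eq, exists_prop]
  rw [this]
  refine Finset.measurableSet_biUnion _ fun i hi => Finset.measurableSet_biUnion _ fun j hj =>
    Finset.measurableSet_biUnion _ fun l hl => ?_
  by_cases h : i < j ∧ j < l
  · have hm : Measurable[sigmaOn U T] fun ω => perimeter (U i ω) (U j ω) (U l ω) :=
      continuous_perimeter.measurable.comp ((measurable_sigmaOn U (hT hi)).prodMk
        ((measurable_sigmaOn U (hT hj)).prodMk (measurable_sigmaOn U (hT hl))))
    simp only [h.1, h.2, true_and]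
    exact hm measurableSet_Ici
  · have : {ω | i < j ∧ j < l ∧ c ≤ perimeter (U i ω) (U j ω) (U l ω)} = ∅ := by
      ext ω
      simp only [Set.mem_ofPred_eq, Set.mem_empty_iff_false, iff_false]
      exact fun h' => h ⟨h'.1, h'.2.1⟩
    rw [this]
    exact @MeasurableSet.empty _ (sigmaOn U T)

/-! ### Probabilities of good triples and of pairs of them -/

section Uniform

variable {Ω : Type*} [MeasurableSpace Ω] {P : Measure Ω} [IsProbabilityMeasure P]
  {U : ℕ → Ω → UnitCircle}

theorem map_pair_eq (hmeas : ∀ i, Measurable (U i)) (hindep : iIndepFun U P)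
    (hunif : ∀ i, P.map (U i) = uniformCircle) {i j : ℕ} (hij : i ≠ j) :
    P.map (fun ω => (U i ω, U j ω)) = uniformCircle.prod uniformCircle := by
  rw [(hindep.indepFun hij).map_prod_eq_prod_map_map (hmeas i).aemeasurable (hmeas j).aemeasurable,
    hunif, hunif]

/-- The probability of an event of which one variable is the first coordinate, by conditioning on
this variable. -/
theorem measure_eq_of_section (hmeas : ∀ i, Measurable (U i)) (hindep : iIndepFun U P)
    (hunif : ∀ i, P.map (U i) = uniformCircle) {β : Type*} [MeasurableSpace β] {i : ℕ}
    {T : Set ℕ} (hi : i ∉ T) {Z : Ω → β} (hZ : Measurable[sigmaOn U T] Z)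
    {E : Set (UnitCircle × β)} (hE : MeasurableSet E) :
    P {ω | (U i ω, Z ω) ∈ E} = ∫⁻ x, P.map Z (Prod.mk x ⁻¹' E) ∂uniformCircle := by
  have hZ' : Measurable Z := hZ.mono (sigmaOn_le hmeas T) le_rfl
  have hI : IndepFun (U i) Z P := indepFun_of_measurable_sigmaOn hmeas hindep
    (Set.disjoint_singleton_left.2 hi) (measurable_sigmaOn U (Set.mem_singleton i)) hZ
  have hprob : IsProbabilityMeasure (P.map Z) := Measure.isProbabilityMeasure_map hZ'.aemeasurable
  rw [← Measure.prod_apply hE, ← hunif i,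
    ← hI.map_prod_eq_prod_map_map (hmeas i).aemeasurable hZ'.aemeasurable,
    Measure.map_apply ((hmeas i).prodMk hZ') hE]
  rfl

theorem measure_goodEvent (hmeas : ∀ i, Measurable (U i)) (hindep : iIndepFun U P)
    (hunif : ∀ i, P.map (U i) = uniformCircle) (r : ℝ) {s : Finset ℕ} (hs : s.card = 3) :
    P (goodEvent U (3 * √3 - r) s) = goodProb r := by
  obtain ⟨i, j, l, hij, hil, hjl, rfl⟩ := Finset.card_eq_three.1 hs
  rw [goodEvent_triple U _ hij hil hjl]
  have h := measure_eq_of_section hmeas hindep hunif (i := i) (T := {j, l})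
    (by simp [hij, hil]) (Z := fun ω => (U j ω, U l ω))
    ((measurable_sigmaOn U (by simp)).prodMk (measurable_sigmaOn U (by simp)))
    (E := {p | 3 * √3 - r ≤ perimeter p.1 p.2.1 p.2.2})
    (measurableSet_le measurable_const continuous_perimeter.measurable)
  refine h.trans ?_
  rw [map_pair_eq hmeas hindep hunif hjl]
  simp only [Set.preimage_ofPred_eq]
  simp_rw [goodProb_eq]
  simp

/-- Given the common vertex the two events are independent, and by rotation invariance each has
conditional probability `goodProb r` whatever that vertex is. -/
theorem measure_goodEvent_inter_of_card_eq_one (hmeas : ∀ i, Measurable (U i))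
    (hindep : iIndepFun U P) (hunif : ∀ i, P.map (U i) = uniformCircle) (r : ℝ) {s s' : Finset ℕ}
    (hs : s.card = 3) (hs' : s'.card = 3) (h : (s ∩ s').card = 1) :
    P (goodEvent U (3 * √3 - r) s ∩ goodEvent U (3 * √3 - r) s') = goodProb r ^ 2 := by
  obtain ⟨i, hi⟩ := Finset.card_eq_one.1 h
  have his : i ∈ s := Finset.mem_of_mem_inter_left (hi ▸ Finset.mem_singleton_self i)
  have his' : i ∈ s' := Finset.mem_of_mem_inter_right (hi ▸ Finset.mem_singleton_self i)
  obtain ⟨j, l, hjl, hse⟩ := Finset.card_eq_two.1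
    (by rw [Finset.card_erase_of_mem his, hs] : (s.erase i).card = 2)
  obtain ⟨m, p, hmp, hse'⟩ := Finset.card_eq_two.1
    (by rw [Finset.card_erase_of_mem his', hs'] : (s'.erase i).card = 2)
  have hd : ∀ a ∈ s.erase i, ∀ b ∈ s'.erase i, a ≠ b := by
    rintro a ha b hb rfl
    have : a ∈ s ∩ s' := Finset.mem_inter.2 ⟨Finset.mem_of_mem_erase ha, Finset.mem_of_mem_erase hb⟩
    rw [hi, Finset.mem_singleton] at this
    exact Finset.ne_of_mem_erase ha this
  have hsi : s = {i, j, l} := by rw [← Finset.insert_erase his, hse]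
  have hsi' : s' = {i, m, p} := by rw [← Finset.insert_erase his', hse']
  have hij : i ≠ j := (Finset.ne_of_mem_erase (by rw [hse]; simp : j ∈ s.erase i)).symm
  have hil : i ≠ l := (Finset.ne_of_mem_erase (by rw [hse]; simp : l ∈ s.erase i)).symm
  have him : i ≠ m := (Finset.ne_of_mem_erase (by rw [hse']; simp : m ∈ s'.erase i)).symm
  have hip : i ≠ p := (Finset.ne_of_mem_erase (by rw [hse']; simp : p ∈ s'.erase i)).symm
  rw [hse, hse'] at hd
  have hjm := hd j (by simp) m (by simp)
  have hjp := hd j (by simp) p (by simp)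
  have hlm := hd l (by simp) m (by simp)
  have hlp := hd l (by simp) p (by simp)
  rw [hsi, hsi', goodEvent_triple U _ hij hil hjl, goodEvent_triple U _ him hip hmp]
  have hE : MeasurableSet {q : UnitCircle × UnitCircle × UnitCircle |
      3 * √3 - r ≤ perimeter q.1 q.2.1 q.2.2} :=
    measurableSet_le measurable_const continuous_perimeter.measurable
  have hm : ∀ {a}, a ∈ ({j, l, m, p} : Set ℕ) → Measurable[sigmaOn U {j, l, m, p}] (U a) :=
    measurable_sigmaOn U
  have h := measure_eq_of_section hmeas hindep hunif (i := i) (T := {j, l, m, p})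
    (by simp [hij, hil, him, hip]) (Z := fun ω => ((U j ω, U l ω), (U m ω, U p ω)))
    (((hm (by simp)).prodMk (hm (by simp))).prodMk ((hm (by simp)).prodMk (hm (by simp))))
    (E := (fun q => (q.1, q.2.1)) ⁻¹' {q | 3 * √3 - r ≤ perimeter q.1 q.2.1 q.2.2} ∩
      (fun q => (q.1, q.2.2)) ⁻¹' {q | 3 * √3 - r ≤ perimeter q.1 q.2.1 q.2.2})
    ((hE.preimage (by fun_prop)).inter (hE.preimage (by fun_prop)))
  refine h.trans ?_
  have hlaw := (hindep.indepFun_prodMk_prodMk hmeas j l m p hjm hjp hlm hlp).map_prod_eq_prod_map_map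
    ((hmeas j).prodMk (hmeas l)).aemeasurable ((hmeas m).prodMk (hmeas p)).aemeasurable
  rw [map_pair_eq hmeas hindep hunif hjl, map_pair_eq hmeas hindep hunif hmp] at hlaw
  rw [hlaw]
  have hsec : ∀ x : UnitCircle, (uniformCircle.prod uniformCircle).prod
      (uniformCircle.prod uniformCircle) (Prod.mk x ⁻¹' ((fun q => (q.1, q.2.1)) ⁻¹'
        {q | 3 * √3 - r ≤ perimeter q.1 q.2.1 q.2.2} ∩
      (fun q => (q.1, q.2.2)) ⁻¹' {q | 3 * √3 - r ≤ perimeter q.1 q.2.1 q.2.2}))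
      = goodProb r ^ 2 := by
    intro x
    rw [sq]
    nth_rewrite 1 [← goodProb_eq x]
    rw [← goodProb_eq x, ← Measure.prod_prod]
    rfl
  simp_rw [hsec]
  simp

/-- Both events force the distances from one common vertex to the other three points to be within
`√(2√3 r)` of `√3`. Given that vertex, these are three independent conditions covered by
`uniformCircle_near_le`. -/
theorem measure_goodEvent_inter_of_card_eq_two (hmeas : ∀ i, Measurable (U i))
    (hindep : iIndepFun U P) (hunif : ∀ i, P.map (U i) = uniformCircle) (r : ℝ) {s s' : Finset ℕ}
    (hs : s.card = 3) (hs' : s'.card = 3) (h : (s ∩ s').card = 2) :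
    P (goodEvent U (3 * √3 - r) s ∩ goodEvent U (3 * √3 - r) s')
      ≤ ENNReal.ofReal (4 * √(2 * √3 * r)) ^ 3 := by
  obtain ⟨i, j, hij, hinter⟩ := Finset.card_eq_two.1 h
  obtain ⟨l, hl⟩ := Finset.card_eq_one.1
    (by have := Finset.card_sdiff_add_card_inter s s'; omega : (s \ s').card = 1)
  obtain ⟨m, hm⟩ := Finset.card_eq_one.1
    (by
      have := Finset.card_sdiff_add_card_inter s' s
      rw [Finset.inter_comm] at this
      omega : (s' \ s).card = 1)
  have hsi : s = {i, j, l} := by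
    rw [← Finset.sdiff_union_inter s s', hl, hinter]
    ext a
    simp only [Finset.mem_union, Finset.mem_insert, Finset.mem_singleton]
    tauto
  have hsi' : s' = {i, j, m} := by
    rw [← Finset.sdiff_union_inter s' s, hm, Finset.inter_comm, hinter]
    ext a
    simp only [Finset.mem_union, Finset.mem_insert, Finset.mem_singleton]
    tauto
  have hlmem : l ∈ s \ s' := by rw [hl]; simp
  have hmmem : m ∈ s' \ s := by rw [hm]; simp
  rw [Finset.mem_sdiff, hsi, hsi'] at hlmem hmmem
  simp only [Finset.mem_insert, Finset.mem_singleton, not_or] at hlmem hmmem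
  obtain ⟨-, hli, hlj, hlm⟩ := hlmem
  obtain ⟨-, hmi, hmj, -⟩ := hmmem
  rw [hsi, hsi', goodEvent_triple U _ hij (Ne.symm hli) (Ne.symm hlj),
    goodEvent_triple U _ hij (Ne.symm hmi) (Ne.symm hmj)]
  set δ := √(2 * √3 * r)
  have hE : MeasurableSet {q : UnitCircle × UnitCircle | |dist q.1 q.2 - √3| ≤ δ} :=
    measurableSet_le (by fun_prop) (by fun_prop)
  have hmT : ∀ {a}, a ∈ ({j, l, m} : Set ℕ) → Measurable[sigmaOn U {j, l, m}] (U a) :=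
    measurable_sigmaOn U
  have h := measure_eq_of_section hmeas hindep hunif (i := i) (T := {j, l, m})
    (by simp [hij, Ne.symm hli, Ne.symm hmi]) (Z := fun ω => ((U j ω, U l ω), U m ω))
    (((hmT (by simp)).prodMk (hmT (by simp))).prodMk (hmT (by simp)))
    (E := (fun q => (q.1, q.2.1.1)) ⁻¹' {q | |dist q.1 q.2 - √3| ≤ δ} ∩
      (fun q => (q.1, q.2.1.2)) ⁻¹' {q | |dist q.1 q.2 - √3| ≤ δ} ∩
      (fun q => (q.1, q.2.2)) ⁻¹' {q | |dist q.1 q.2 - √3| ≤ δ})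
    (((hE.preimage (by fun_prop)).inter (hE.preimage (by fun_prop))).inter
      (hE.preimage (by fun_prop)))
  have hsub : {ω | 3 * √3 - r ≤ perimeter (U i ω) (U j ω) (U l ω)} ∩
      {ω | 3 * √3 - r ≤ perimeter (U i ω) (U j ω) (U m ω)} ⊆
      {ω | (U i ω, ((U j ω, U l ω), U m ω)) ∈
        ((fun q => (q.1, q.2.1.1)) ⁻¹' {q | |dist q.1 q.2 - √3| ≤ δ} ∩
      (fun q => (q.1, q.2.1.2)) ⁻¹' {q | |dist q.1 q.2 - √3| ≤ δ} ∩
      (fun q => (q.1, q.2.2)) ⁻¹' {q | |dist q.1 q.2 - √3| ≤ δ} :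
        Set (UnitCircle × (UnitCircle × UnitCircle) × UnitCircle))} := by
    rintro ω ⟨h1, h2⟩
    refine ⟨⟨?_, ?_⟩, ?_⟩
    · exact Real.abs_le_sqrt (sq_dist_sub_sqrt_three_le h1)
    · exact Real.abs_le_sqrt (sq_dist_sub_sqrt_three_le (h1.trans_eq (perimeter_swap _ _ _)))
    · exact Real.abs_le_sqrt (sq_dist_sub_sqrt_three_le (h2.trans_eq (perimeter_swap _ _ _)))
  refine (measure_mono hsub).trans (h.trans_le ?_)
  have hlaw := (hindep.indepFun_prodMk hmeas j l m (Ne.symm hmj) hlm).map_prod_eq_prod_map_map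
    ((hmeas j).prodMk (hmeas l)).aemeasurable (hmeas m).aemeasurable
  rw [map_pair_eq hmeas hindep hunif (Ne.symm hlj), hunif] at hlaw
  rw [hlaw]
  have hsec : ∀ x : UnitCircle, ((uniformCircle.prod uniformCircle).prod uniformCircle)
      (Prod.mk x ⁻¹' ((fun q => (q.1, q.2.1.1)) ⁻¹' {q | |dist q.1 q.2 - √3| ≤ δ} ∩
      (fun q => (q.1, q.2.1.2)) ⁻¹' {q | |dist q.1 q.2 - √3| ≤ δ} ∩
      (fun q => (q.1, q.2.2)) ⁻¹' {q | |dist q.1 q.2 - √3| ≤ δ}))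
      ≤ ENNReal.ofReal (4 * δ) ^ 3 := by
    intro x
    have hx := uniformCircle_near_le x (Real.sqrt_nonneg (2 * √3 * r))
    calc _ = uniformCircle {y | |dist x y - √3| ≤ δ} * uniformCircle {y | |dist x y - √3| ≤ δ}
          * uniformCircle {y | |dist x y - √3| ≤ δ} := by
          rw [← Measure.prod_prod, ← Measure.prod_prod]
          rfl
      _ ≤ ENNReal.ofReal (4 * δ) * ENNReal.ofReal (4 * δ) * ENNReal.ofReal (4 * δ) := by gcongr
      _ = _ := by ring
  calc _ ≤ ∫⁻ _, ENNReal.ofReal (4 * δ) ^ 3 ∂uniformCircle := lintegral_mono fun x => hsec x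
    _ = _ := by simp

end Uniform

/-! ### From the maximum to counting triples -/

theorem le_maxPerimeter_iff (u : ℕ → UnitCircle) {n : ℕ} (hn : 3 ≤ n) (c : ℝ) :
    c ≤ maxPerimeter u n ↔
      ∃ i j l : ℕ, i < j ∧ j < l ∧ l < n ∧ c ≤ perimeter (u i) (u j) (u l) := by
  have hfin : {r : ℝ | ∃ i j l : ℕ, i < j ∧ j < l ∧ l < n ∧
      r = perimeter (u i) (u j) (u l)}.Finite := by
    refine Set.Finite.subset (((Set.finite_lt_nat n).prod ((Set.finite_lt_nat n).prod
      (Set.finite_lt_nat n))).image fun p => perimeter (u p.1) (u p.2.1) (u p.2.2)) ?_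
    rintro r ⟨i, j, l, h1, h2, h3, rfl⟩
    exact ⟨(i, j, l), ⟨(h1.trans h2).trans h3, h2.trans h3, h3⟩, rfl⟩
  constructor
  · intro h
    have hne : {r : ℝ | ∃ i j l : ℕ, i < j ∧ j < l ∧ l < n ∧
        r = perimeter (u i) (u j) (u l)}.Nonempty :=
      ⟨_, 0, 1, 2, zero_lt_one, one_lt_two, by omega, rfl⟩
    obtain ⟨i, j, l, h1, h2, h3, h4⟩ := hne.csSup_mem hfin
    exact ⟨i, j, l, h1, h2, h3, h.trans_eq h4⟩
  · rintro ⟨i, j, l, h1, h2, h3, h4⟩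
    exact h4.trans (le_csSup hfin.bddAbove ⟨i, j, l, h1, h2, h3, rfl⟩)

/-- The index sets of the triangles with vertices among the first `n` points. -/
abbrev triples (n : ℕ) : Finset (Finset ℕ) := Finset.powersetCard 3 (Finset.range n)

theorem hits_goodEvent_ne_zero_iff {Ω : Type*} (U : ℕ → Ω → UnitCircle) {n : ℕ} (hn : 3 ≤ n)
    (c : ℝ) (ω : Ω) :
    hits (goodEvent U c) (triples n) ω ≠ 0 ↔ c ≤ maxPerimeter (fun i => U i ω) n := by
  rw [le_maxPerimeter_iff _ hn, Ne, hits_eq_zero_iff]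
  push Not
  constructor
  · rintro ⟨s, hs, i, -, j, -, l, hl, h1, h2, h⟩
    exact ⟨i, j, l, h1, h2, Finset.mem_range.1 ((Finset.mem_powersetCard.1 hs).1 hl), h⟩
  · rintro ⟨i, j, l, h1, h2, h3, h⟩
    refine ⟨{i, j, l}, Finset.mem_powersetCard.2 ⟨?_, Finset.card_eq_three.2
      ⟨i, j, l, h1.ne, (h1.trans h2).ne, h2.ne, rfl⟩⟩, ?_⟩
    · intro a ha
      simp only [Finset.mem_insert, Finset.mem_singleton] at ha
      rw [Finset.mem_range]
      omega
    · rw [goodEvent_triple U c h1.ne (h1.trans h2).ne h2.ne]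
      exact h

/-- The triples that meet `s`. -/
def meeting (n : ℕ) (s : Finset ℕ) : Finset (Finset ℕ) :=
  (triples n).filter fun s' => ¬ Disjoint s s'

theorem mem_meeting {n : ℕ} {s s' : Finset ℕ} :
    s' ∈ meeting n s ↔ s' ∈ triples n ∧ ¬ Disjoint s s' :=
  Finset.mem_filter

theorem card_meeting_le {n : ℕ} {s : Finset ℕ} (hs : s.card = 3) :
    (meeting n s).card ≤ 3 * n ^ 2 := by
  have hsub : meeting n s ⊆ (s ×ˢ Finset.range n ×ˢ Finset.range n).image
      fun p => {p.1, p.2.1, p.2.2} := by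
    intro s' h
    obtain ⟨h1, h2⟩ := mem_meeting.1 h
    obtain ⟨hr, hc⟩ := Finset.mem_powersetCard.1 h1
    obtain ⟨i, hi, hi'⟩ := Finset.not_disjoint_iff.1 h2
    obtain ⟨j, l, -, hjl⟩ := Finset.card_eq_two.1
      (by rw [Finset.card_erase_of_mem hi', hc] : (s'.erase i).card = 2)
    have hj : j ∈ s'.erase i := by rw [hjl]; simp
    have hl : l ∈ s'.erase i := by rw [hjl]; simp
    refine Finset.mem_image.2 ⟨(i, j, l), Finset.mem_product.2 ⟨hi, Finset.mem_product.2
      ⟨hr (Finset.mem_of_mem_erase hj), hr (Finset.mem_of_mem_erase hl)⟩⟩, ?_⟩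
    rw [← Finset.insert_erase hi', hjl]
  refine (Finset.card_le_card hsub).trans (Finset.card_image_le.trans (le_of_eq ?_))
  rw [Finset.card_product, Finset.card_product, Finset.card_range, hs]
  ring

theorem card_filter_two_le_card_inter_le {n : ℕ} {s : Finset ℕ} (hs : s.card = 3) :
    ((triples n).filter fun s' => 2 ≤ (s ∩ s').card).card ≤ 9 * n := by
  have hsub : (triples n).filter (fun s' => 2 ≤ (s ∩ s').card) ⊆
      (s ×ˢ s ×ˢ Finset.range n).image fun p => {p.1, p.2.1, p.2.2} := by
    intro s' h
    obtain ⟨h1, h2⟩ := Finset.mem_filter.1 h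
    obtain ⟨hr, hc⟩ := Finset.mem_powersetCard.1 h1
    obtain ⟨i, hi, j, hj, hij⟩ := Finset.one_lt_card.1 h2
    rw [Finset.mem_inter] at hi hj
    have hj' : j ∈ s'.erase i := Finset.mem_erase.2 ⟨hij.symm, hj.2⟩
    obtain ⟨l, hl⟩ := Finset.card_eq_one.1 (by
      rw [Finset.card_erase_of_mem hj', Finset.card_erase_of_mem hi.2, hc] :
        ((s'.erase i).erase j).card = 1)
    have hl' : l ∈ (s'.erase i).erase j := by rw [hl]; simp
    refine Finset.mem_image.2 ⟨(i, j, l), Finset.mem_product.2 ⟨hi.1, Finset.mem_product.2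
      ⟨hj.1, hr (Finset.mem_of_mem_erase (Finset.mem_of_mem_erase hl'))⟩⟩, ?_⟩
    rw [← Finset.insert_erase hi.2, ← Finset.insert_erase hj', hl]
  refine (Finset.card_le_card hsub).trans (Finset.card_image_le.trans (le_of_eq ?_))
  rw [Finset.card_product, Finset.card_product, Finset.card_range, hs]
  ring

/-- The triples left after removing `meeting n s` use only indices outside `s`. -/
theorem indepFun_goodEvent_hits {Ω : Type*} [MeasurableSpace Ω] {P : Measure Ω}
    {U : ℕ → Ω → UnitCircle} (hmeas : ∀ i, Measurable (U i)) (hindep : iIndepFun U P)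
    (c : ℝ) (n : ℕ) (s : Finset ℕ) :
    IndepFun ((goodEvent U c s).indicator (1 : Ω → ℝ))
      (hits (goodEvent U c) (triples n \ meeting n s)) P := by
  refine indepFun_of_measurable_sigmaOn hmeas hindep (S := ↑s) (T := (↑s)ᶜ)
    disjoint_compl_right ?_ ?_
  · exact (@measurable_const _ _ _ (sigmaOn U ↑s) 1).indicator
      (measurableSet_goodEvent U c s subset_rfl)
  · refine Finset.measurable_fun_sum _ fun s' hs' => ?_
    refine (@measurable_const _ _ _ (sigmaOn U (↑s)ᶜ) 1).indicator
      (measurableSet_goodEvent U c s' ?_)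
    rw [Finset.mem_sdiff, mem_meeting] at hs'
    have : Disjoint s s' := by tauto
    exact Set.disjoint_left.1 (Finset.disjoint_coe.2 this.symm)

/-! ### Poisson approximation for good triangles -/

section Uniform

variable {Ω : Type*} [MeasurableSpace Ω] {P : Measure Ω} [IsProbabilityMeasure P]
  {U : ℕ → Ω → UnitCircle}

/-- Poisson approximation of the number of almost maximal triangles. -/
theorem abs_measureReal_hits_goodEvent_sub_le (hmeas : ∀ i, Measurable (U i))
    (hindep : iIndepFun U P) (hunif : ∀ i, P.map (U i) = uniformCircle) (r : ℝ) (n : ℕ) :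
    |P.real {ω | hits (goodEvent U (3 * √3 - r)) (triples n) ω = 0}
        - Real.exp (-(n.choose 3 * (goodProb r).toReal))|
      ≤ n.choose 3 * (6 * n ^ 2 * (goodProb r).toReal ^ 2
        + 9 * n * (4 * √(2 * √3 * r)) ^ 3) := by
  set p := (goodProb r).toReal with hp
  set b := 4 * √(2 * √3 * r) with hb
  have hb0 : 0 ≤ b := by positivity
  have hcard : (triples n).card = n.choose 3 := by
    rw [Finset.card_powersetCard, Finset.card_range]
  have hprob : ∀ s ∈ triples n, P.real (goodEvent U (3 * √3 - r) s) = p := fun s hs => by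
    rw [measureReal_def, measure_goodEvent hmeas hindep hunif r (Finset.mem_powersetCard.1 hs).2]
  have hsum : ∑ s ∈ triples n, P.real (goodEvent U (3 * √3 - r) s) = n.choose 3 * p := by
    rw [Finset.sum_congr rfl hprob, Finset.sum_const, hcard, nsmul_eq_mul]
  have h := abs_measureReal_hits_eq_zero_sub_exp_le P (triples n) (goodEvent U (3 * √3 - r))
    (fun s => sigmaOn_le hmeas Set.univ _ (measurableSet_goodEvent U _ s (Set.subset_univ _)))
    (meeting n)
    (fun s hs => mem_meeting.2 ⟨hs, by
      rw [disjoint_self]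
      rintro rfl
      simpa using (Finset.mem_powersetCard.1 hs).2⟩)
    (fun s _ => Finset.filter_subset _ _)
    (fun s _ => indepFun_goodEvent_hits hmeas hindep _ n s)
  rw [hsum] at h
  refine h.trans ?_
  have hterm : ∀ s ∈ triples n, ∑ s' ∈ meeting n s, P.real (goodEvent U (3 * √3 - r) s)
      * P.real (goodEvent U (3 * √3 - r) s') + ∑ s' ∈ (meeting n s).erase s,
        P.real (goodEvent U (3 * √3 - r) s ∩ goodEvent U (3 * √3 - r) s')
      ≤ 6 * n ^ 2 * p ^ 2 + 9 * n * b ^ 3 := by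
    intro s hs
    have hs3 := (Finset.mem_powersetCard.1 hs).2
    have hN : ((meeting n s).card : ℝ) ≤ 3 * n ^ 2 := by exact_mod_cast card_meeting_le hs3
    have hF : (((triples n).filter fun s' => 2 ≤ (s ∩ s').card).card : ℝ) ≤ 9 * n := by
      exact_mod_cast card_filter_two_le_card_inter_le hs3
    have e1 : ∑ s' ∈ meeting n s, P.real (goodEvent U (3 * √3 - r) s)
        * P.real (goodEvent U (3 * √3 - r) s') ≤ 3 * n ^ 2 * p ^ 2 := by
      rw [Finset.sum_congr rfl fun s' hs' => by
        rw [hprob s hs, hprob s' (mem_meeting.1 hs').1, ← sq], Finset.sum_const, nsmul_eq_mul]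
      gcongr
    -- A neighbour other than `s` shares one or two vertices with it. The larger bound `b ^ 3` is
    -- charged only to the at most `9 n` triples sharing two or more; `p ^ 2` is charged to all.
    have e2 : ∀ s' ∈ (meeting n s).erase s,
        P.real (goodEvent U (3 * √3 - r) s ∩ goodEvent U (3 * √3 - r) s')
          ≤ p ^ 2 + if 2 ≤ (s ∩ s').card then b ^ 3 else 0 := by
      intro s' hs'
      obtain ⟨hne, hmem⟩ := Finset.mem_erase.1 hs'
      obtain ⟨ht, hdis⟩ := mem_meeting.1 hmem
      have hs3' := (Finset.mem_powersetCard.1 ht).2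
      have hpos : 0 < (s ∩ s').card := by
        rw [Finset.card_pos, ← Finset.not_disjoint_iff_nonempty_inter]
        exact hdis
      have hlt : (s ∩ s').card < 3 := by
        by_contra! hge
        refine hne ?_
        have h1 : s ∩ s' = s := Finset.eq_of_subset_of_card_le Finset.inter_subset_left (by omega)
        have h2 : s ∩ s' = s' := Finset.eq_of_subset_of_card_le Finset.inter_subset_right (by omega)
        exact h2.symm.trans h1
      by_cases h2 : 2 ≤ (s ∩ s').card
      · rw [if_pos h2]
        have := ENNReal.toReal_mono (by finiteness) (measure_goodEvent_inter_of_card_eq_two hmeas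
          hindep hunif r hs3 hs3' (by omega))
        rw [ENNReal.toReal_pow, ENNReal.toReal_ofReal hb0] at this
        rw [measureReal_def]
        exact this.trans (le_add_of_nonneg_left (sq_nonneg p))
      · rw [if_neg h2, add_zero, measureReal_def, measure_goodEvent_inter_of_card_eq_one hmeas
          hindep hunif r hs3 hs3' (by omega), ENNReal.toReal_pow]
    have e3 : ∑ s' ∈ (meeting n s).erase s,
        P.real (goodEvent U (3 * √3 - r) s ∩ goodEvent U (3 * √3 - r) s')
          ≤ 3 * n ^ 2 * p ^ 2 + 9 * n * b ^ 3 := by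
      calc _ ≤ ∑ s' ∈ (meeting n s).erase s, (p ^ 2 + if 2 ≤ (s ∩ s').card then b ^ 3 else 0) :=
            Finset.sum_le_sum e2
        _ = ((meeting n s).erase s).card * p ^ 2
            + ∑ s' ∈ (meeting n s).erase s, (if 2 ≤ (s ∩ s').card then b ^ 3 else 0) := by
            rw [Finset.sum_add_distrib, Finset.sum_const, nsmul_eq_mul]
        _ ≤ (meeting n s).card * p ^ 2
            + ∑ s' ∈ triples n, (if 2 ≤ (s ∩ s').card then b ^ 3 else 0) := by
            refine add_le_add ?_ (Finset.sum_le_sum_of_subset_of_nonneg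
              ((Finset.erase_subset _ _).trans (Finset.filter_subset _ _)) fun _ _ _ => by positivity)
            gcongr
            exact Finset.erase_subset _ _
        _ = (meeting n s).card * p ^ 2
            + ((triples n).filter fun s' => 2 ≤ (s ∩ s').card).card * b ^ 3 := by
            rw [← Finset.sum_filter, Finset.sum_const, nsmul_eq_mul]
        _ ≤ _ := by gcongr
    linarith
  refine (Finset.sum_le_sum hterm).trans (le_of_eq ?_)
  rw [Finset.sum_const, hcard, nsmul_eq_mul]

end Uniform

/-! ### Asymptotics in `n` -/

theorem cast_choose_three (n : ℕ) : (n.choose 3 : ℝ) = n * (n - 1) * (n - 2) / 6 := by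
  induction n with
  | zero => simp
  | succ k ih =>
    rw [Nat.choose_succ_succ' k 2, Nat.cast_add, ih, Nat.cast_choose_two]
    push_cast
    ring

theorem abs_exp_neg_sub_exp_neg_le {a b : ℝ} (ha : 0 ≤ a) (hb : 0 ≤ b) :
    |Real.exp (-a) - Real.exp (-b)| ≤ |a - b| := by
  have key : ∀ {x y : ℝ}, 0 ≤ x → Real.exp (-x) - Real.exp (-y) ≤ |x - y| := by
    intro x y hx
    rcases le_total x y with h | h
    · have h1 : Real.exp (-y) = Real.exp (-x) * Real.exp (x - y) := by
        rw [← Real.exp_add]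
        ring_nf
      have h2 := Real.add_one_le_exp (x - y)
      have h3 : Real.exp (-x) ≤ 1 := Real.exp_le_one_iff.2 (by linarith)
      rw [abs_of_nonpos (by linarith), h1]
      nlinarith [Real.exp_pos (-x)]
    · have : Real.exp (-x) ≤ Real.exp (-y) := Real.exp_le_exp.2 (by linarith)
      linarith [abs_nonneg (x - y)]
  rw [abs_le]
  have h1 := key (y := b) ha
  have h2 := key (y := a) hb
  rw [abs_sub_comm] at h2
  constructor <;> linarith

/-- The expected number of almost maximal triangles. -/
theorem abs_choose_mul_goodProb_sub_le {t : ℝ} (ht : 0 < t) {n : ℕ} (hn : 3 ≤ n)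
    (hs : t / n ^ 3 ≤ 4 / 25) :
    |n.choose 3 * (goodProb (t / n ^ 3)).toReal - 2 * t / (9 * Real.pi)|
      ≤ (t + t * √t) * (1 / √n) := by
  have hn1 : (3 : ℝ) ≤ n := by exact_mod_cast hn
  have hpi := Real.pi_gt_three
  have hp := abs_goodProb_sub_le (by positivity) hs
  set p := (goodProb (t / n ^ 3)).toReal
  -- With `x = √n` all half-integer powers of `n` become integer powers of `x`.
  obtain ⟨x, hx, hxn⟩ : ∃ x : ℝ, 1 ≤ x ∧ x ^ 2 = n :=
    ⟨√n, Real.one_le_sqrt.2 (by linarith), Real.sq_sqrt (by positivity)⟩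
  have hx0 : 0 < x := by linarith
  have hC := cast_choose_three n
  rw [← hxn] at hC hp hn1 ⊢
  rw [Real.sqrt_sq hx0.le]
  have hsq : √(t / (x ^ 2) ^ 3) = √t / x ^ 3 := by
    rw [Real.sqrt_div ht.le, show (x ^ 2) ^ 3 = (x ^ 3) ^ 2 by ring, Real.sqrt_sq (by positivity)]
  rw [hsq] at hp
  have hC0 : (0 : ℝ) ≤ n.choose 3 := by positivity
  have hC1 : (n.choose 3 : ℝ) ≤ x ^ 6 / 6 := by rw [hC]; nlinarith
  have hC2 : x ^ 6 / 6 - n.choose 3 ≤ x ^ 4 / 2 := by rw [hC]; nlinarith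
  -- Split the error into that of `goodProb`, of order `x⁶ · x⁻⁹`, and that of replacing `n.choose
  -- 3` by `n³ / 6`, of order `x⁻²`.
  have e : n.choose 3 * p - 2 * t / (9 * Real.pi)
      = n.choose 3 * (p - 4 * (t / (x ^ 2) ^ 3) / (3 * Real.pi))
        - (x ^ 6 / 6 - n.choose 3) * (4 * t / (3 * Real.pi * x ^ 6)) := by
    field_simp
    ring
  rw [e]
  refine (abs_sub _ _).trans ?_
  rw [abs_mul, abs_mul, abs_of_nonneg hC0, abs_of_nonneg (a := x ^ 6 / 6 - _) (by linarith),
    abs_of_pos (a := 4 * t / _) (by positivity)]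
  have b1 : n.choose 3 * |p - 4 * (t / (x ^ 2) ^ 3) / (3 * Real.pi)| ≤ t * √t * (1 / x) := by
    calc _ ≤ x ^ 6 / 6 * (4 * (t / (x ^ 2) ^ 3 * (√t / x ^ 3))) := by gcongr
      _ = 2 / 3 * (t * √t) * (1 / x ^ 3) := by
        field_simp
        ring
      _ ≤ 1 * (t * √t) * (1 / x) := by
        gcongr
        · norm_num
        · exact le_self_pow₀ hx (by norm_num)
      _ = _ := by ring
  have b2 : (x ^ 6 / 6 - n.choose 3) * (4 * t / (3 * Real.pi * x ^ 6)) ≤ t * (1 / x) := by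
    calc _ ≤ x ^ 4 / 2 * (4 * t / (3 * Real.pi * x ^ 6)) := by gcongr
      _ = 2 / (3 * Real.pi) * t * (1 / x ^ 2) := by
        field_simp
        ring
      _ ≤ 1 * t * (1 / x) := by
        gcongr
        · rw [div_le_one (by positivity)]
          linarith
        · exact le_self_pow₀ hx (by norm_num)
      _ = _ := by ring
  linarith

/-- With `s = t / n³`, the one-vertex term is of order `n³ · n² · n⁻⁶ = n⁻¹`, the two-vertex term of
order `n³ · n · n^(-9/2) = n^(-1/2)`. -/
theorem choose_mul_error_le {t : ℝ} (ht : 0 < t) {n : ℕ} (hn : 3 ≤ n)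
    (hs : t / n ^ 3 ≤ 4 / 25) :
    n.choose 3 * (6 * n ^ 2 * (goodProb (t / n ^ 3)).toReal ^ 2
        + 9 * n * (4 * √(2 * √3 * (t / n ^ 3))) ^ 3)
      ≤ (54 * t ^ 2 + 9 * (4 * √(2 * √3 * t)) ^ 3) * (1 / √n) := by
  have hn1 : (3 : ℝ) ≤ n := by exact_mod_cast hn
  have hpi := Real.pi_gt_three
  have hp := (abs_le.1 (abs_goodProb_sub_le (by positivity) hs)).2
  have hp0 : 0 ≤ (goodProb (t / n ^ 3)).toReal := ENNReal.toReal_nonneg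
  have hr0 : 0 < t / n ^ 3 := by positivity
  have hroot := sqrt_le_of_le_four_div hs
  have hp3 : (goodProb (t / n ^ 3)).toReal ≤ 3 * (t / n ^ 3) := by
    have h1 : 4 * (t / n ^ 3) / (3 * Real.pi) ≤ t / n ^ 3 := by
      rw [div_le_iff₀ (by positivity)]
      nlinarith
    nlinarith
  set p := (goodProb (t / n ^ 3)).toReal
  obtain ⟨x, hx, hxn⟩ : ∃ x : ℝ, 1 ≤ x ∧ x ^ 2 = n :=
    ⟨√n, Real.one_le_sqrt.2 (by linarith), Real.sq_sqrt (by positivity)⟩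
  have hx0 : 0 < x := by linarith
  have hC := cast_choose_three n
  rw [← hxn] at hC hp3 hn1 ⊢
  rw [Real.sqrt_sq hx0.le]
  have hsq : √(2 * √3 * (t / (x ^ 2) ^ 3)) = √(2 * √3 * t) / x ^ 3 := by
    rw [← mul_div_assoc, Real.sqrt_div (by positivity), show (x ^ 2) ^ 3 = (x ^ 3) ^ 2 by ring,
      Real.sqrt_sq (by positivity)]
  have hC1 : (n.choose 3 : ℝ) ≤ x ^ 6 := by rw [hC]; nlinarith
  rw [hsq]
  set B := √(2 * √3 * t)
  have hB : 0 ≤ B := Real.sqrt_nonneg _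
  calc _ ≤ x ^ 6 * (6 * (x ^ 2) ^ 2 * (3 * (t / (x ^ 2) ^ 3)) ^ 2
        + 9 * x ^ 2 * (4 * (B / x ^ 3)) ^ 3) := by gcongr
    _ = 54 * t ^ 2 * (1 / x ^ 2) + 9 * (4 * B) ^ 3 * (1 / x) := by
      field_simp
      ring
    _ ≤ 54 * t ^ 2 * (1 / x) + 9 * (4 * B) ^ 3 * (1 / x) := by
      gcongr
      exact le_self_pow₀ hx (by norm_num)
    _ = _ := by ring

end

theorem mainTheorem5 {Ω : Type*} [MeasurableSpace Ω] (P : Measure Ω) [IsProbabilityMeasure P]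
    (U : ℕ → Ω → UnitCircle) (hmeas : ∀ i, Measurable (U i))
    (hindep : iIndepFun U P) (hunif : ∀ i, P.map (U i) = uniformCircle)
    (t : ℝ) (ht : 0 < t) :
    Tendsto
      (fun n : ℕ => P.real {ω | (n : ℝ) ^ 3 * (3 * √3 - maxPerimeter (fun i => U i ω) n) ≤ t})
      atTop (𝓝 (1 - Real.exp (-(2 * t / (9 * Real.pi))))) ∧
    (fun n : ℕ =>
        P.real {ω | (n : ℝ) ^ 3 * (3 * √3 - maxPerimeter (fun i => U i ω) n) ≤ t}
          - (1 - Real.exp (-(2 * t / (9 * Real.pi)))))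
      =O[atTop] (fun n : ℕ => (n : ℝ) ^ (-(1 / 2) : ℝ)) := by
  -- All estimates of `goodProb` require `s ≤ 4/25`.
  have hsmall : ∀ᶠ n : ℕ in atTop, t / (n : ℝ) ^ 3 ≤ 4 / 25 := by
    have : Tendsto (fun n : ℕ => t / (n : ℝ) ^ 3) atTop (𝓝 0) :=
      tendsto_const_nhds.div_atTop
        ((tendsto_pow_atTop (by norm_num)).comp tendsto_natCast_atTop_atTop)
    exact this.eventually_le_const (by norm_num)
  have hO : (fun n : ℕ =>
        P.real {ω | (n : ℝ) ^ 3 * (3 * √3 - maxPerimeter (fun i => U i ω) n) ≤ t}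
          - (1 - Real.exp (-(2 * t / (9 * Real.pi)))))
      =O[atTop] (fun n : ℕ => (n : ℝ) ^ (-(1 / 2) : ℝ)) := by
    refine IsBigO.of_bound (54 * t ^ 2 + 9 * (4 * √(2 * √3 * t)) ^ 3 + (t + t * √t)) ?_
    filter_upwards [hsmall, eventually_ge_atTop 3] with n hs hn
    have hn0 : (0 : ℝ) < n := by
      have : 0 < n := by omega
      exact_mod_cast this
    have hset : {ω | (n : ℝ) ^ 3 * (3 * √3 - maxPerimeter (fun i => U i ω) n) ≤ t}
        = {ω | hits (goodEvent U (3 * √3 - t / n ^ 3)) (triples n) ω = 0}ᶜ := by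
      ext ω
      have h := hits_goodEvent_ne_zero_iff U hn (3 * √3 - t / n ^ 3) ω
      simp only [Set.mem_compl_iff, Set.mem_ofPred_eq]
      rw [← Ne, h, sub_le_comm, le_div_iff₀ (by positivity), mul_comm]
    have hm : MeasurableSet {ω | hits (goodEvent U (3 * √3 - t / n ^ 3)) (triples n) ω = 0} :=
      measurable_hits (fun s => sigmaOn_le hmeas Set.univ _
        (measurableSet_goodEvent U _ s (Set.subset_univ _))) (triples n) (measurableSet_singleton 0)
    rw [hset, probReal_compl_eq_one_sub hm]
    have h1 := abs_measureReal_hits_goodEvent_sub_le hmeas hindep hunif (t / n ^ 3) n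
    have h2 := choose_mul_error_le ht hn hs
    have h3 := abs_choose_mul_goodProb_sub_le ht hn hs
    have h4 := abs_exp_neg_sub_exp_neg_le
      (a := n.choose 3 * (goodProb (t / n ^ 3)).toReal) (b := 2 * t / (9 * Real.pi))
      (by positivity) (by positivity)
    have hpow : ‖(n : ℝ) ^ (-(1 / 2) : ℝ)‖ = 1 / √n := by
      rw [Real.norm_of_nonneg (by positivity), Real.rpow_neg hn0.le, ← Real.sqrt_eq_rpow, one_div]
    -- Swapping the difference turns it into `P(no good triple) - exp (-2t/(9π))`, which is compared
    -- with `exp` of minus the exact mean.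
    rw [hpow, Real.norm_eq_abs, abs_sub_comm]
    have h5 := abs_le.1 (h1.trans h2)
    have h6 := abs_le.1 (h4.trans h3)
    rw [add_mul, abs_le]
    constructor <;> linarith [h5.1, h5.2, h6.1, h6.2]
  refine ⟨?_, hO⟩
  have hzero : Tendsto (fun n : ℕ => (n : ℝ) ^ (-(1 / 2) : ℝ)) atTop (𝓝 0) :=
    (tendsto_rpow_neg_atTop (by norm_num)).comp tendsto_natCast_atTop_atTop
  exact tendsto_sub_nhds_zero_iff.1 (hO.trans_tendsto hzero)
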